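/- Let $S>0$ and, for $0<h<S$ and $j\in\mathbb N=\{0,1,2,\dots\}$, let $\|t^j\|_h>0$ be real numbers such that, with $R(h,j):=\|t^{j+1}\|_h/\|t^j\|_h$, (a) $\|t^{i+j}\|_h\le\|t^i\|_h\,\|t^j\|_h$ for all $h,i,j$; (b) $\|t^j\|_h\le 1$ and $R(h,j)\le 1$ for all $h,j$; (c) $R(h,j)\to 0$ as $j\to\infty$, for every $h$; (d) for all $h<k$ there is a constant $K_{h,k}>0$ with $\|t^j\|_h\le K_{h,k}\min\{j^{-1},R(k,j)\}\,\|t^j\|_k$ for all $j\ge 1$. Let $A_h$ be the Banach algebra of all $\sum_{j\ge0} a_jt^j\in\mathbb C[[t]]$ with $\|\sum_j a_jt^j\|_h:=\sum_j|a_j|\,\|t^j\|_h<\infty$. For $0<h\le S$ let $A_{\hat h}:=\varprojlim_{l<h}A_l=\bigcap_{0<l<h}A_l$, a subring of $\mathbb C[[t]]$ with the projective limit topology. Let $X$ be a complex manifold, $x\in X$, and let $\mathcal A^{\hat h}_X$ be the sheaf of holomorphic functions on $X$ with values in $A_{\hat h}$, i.e. of functions $U\to A_{\hat h}$ that are holomorphic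 as maps to the Banach space $A_l$ for every $l<h$. Let $\mathcal A^{\hat h}_{X,x}$ be its stalk at $x$. **Proposition.** If $0<k<h\le S$, then $\mathcal A^{\hat k}_{X,x}$ is faithfully flat over $\mathcal A^{\hat h}_{X,x}$, via the homomorphism induced by the inclusion $A_{\hat h}\subseteq A_{\hat k}$. -/

import Mathlib

open scoped PowerSeries Manifold ContDiff Topology

/-- The numbers `W.w h j = ‖t ^ j‖_h` for the levels `0 < h < S`, subject to the Banach algebra
condition, the normalization, locality and controlled nuclearity. -/
structure WeightFamily (S : ℝ) where
  /-- `w h j` is the norm of `t ^ j` at level `h`. -/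
  w : Set.Ioo (0 : ℝ) S → ℕ → ℝ
  pos : ∀ h j, 0 < w h j
  /-- Banach algebra condition. -/
  submul : ∀ h i j, w h (i + j) ≤ w h i * w h j
  /-- Normalization, first half. -/
  le_one : ∀ h j, w h j ≤ 1
  /-- Normalization, second half: `R(h, j) = ‖t ^ (j + 1)‖_h / ‖t ^ j‖_h ≤ 1`. -/
  ratio_le_one : ∀ h j, w h (j + 1) / w h j ≤ 1
  /-- Locality: `R(h, j) → 0`. -/
  locality : ∀ h, Filter.Tendsto (fun j => w h (j + 1) / w h j) Filter.atTop (𝓝 0)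
  /-- Controlled nuclearity. (For `j = 0` the term `j⁻¹` reads `∞`, and what remains
  holds after enlarging `K`.) -/
  nuclearity : ∀ h k, h < k → ∃ K : ℝ, 0 < K ∧ ∀ j : ℕ, 1 ≤ j →
    w h j ≤ K * min ((j : ℝ)⁻¹) (w k (j + 1) / w k j) * w k j

namespace WeightFamily

variable {S : ℝ} (W : WeightFamily S)

lemma w_zero (h : Set.Ioo (0 : ℝ) S) : W.w h 0 = 1 := by
  have h1 := W.submul h 0 0
  have h2 := W.pos h 0
  have h3 := W.le_one h 0
  simp only [add_zero] at h1
  nlinarith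

/-- The terms `|a_j| ‖t ^ j‖_h`. -/
noncomputable def term (h : Set.Ioo (0 : ℝ) S) (f : ℂ⟦X⟧) (j : ℕ) : ℝ :=
  ‖PowerSeries.coeff j f‖ * W.w h j

lemma term_nonneg (h : Set.Ioo (0 : ℝ) S) (f : ℂ⟦X⟧) (j : ℕ) : 0 ≤ W.term h f j :=
  mul_nonneg (norm_nonneg _) (W.pos h j).le

lemma term_add_le (h : Set.Ioo (0 : ℝ) S) (f g : ℂ⟦X⟧) (j : ℕ) :
    W.term h (f + g) j ≤ W.term h f j + W.term h g j := by
  unfold term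
  rw [map_add, ← add_mul]
  exact mul_le_mul_of_nonneg_right (norm_add_le _ _) (W.pos h j).le

lemma term_mul_le (h : Set.Ioo (0 : ℝ) S) (f g : ℂ⟦X⟧) (j : ℕ) :
    W.term h (f * g) j ≤
      ∑ p ∈ Finset.HasAntidiagonal.antidiagonal j, W.term h f p.1 * W.term h g p.2 := by
  unfold term
  rw [PowerSeries.coeff_mul]
  calc _ ≤ (∑ p ∈ Finset.HasAntidiagonal.antidiagonal j,
            ‖PowerSeries.coeff p.1 f * PowerSeries.coeff p.2 g‖) * W.w h j :=
        mul_le_mul_of_nonneg_right (norm_sum_le _ _) (W.pos h j).le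
    _ ≤ _ := by
        rw [Finset.sum_mul]
        refine Finset.sum_le_sum fun p hp => ?_
        rw [← Finset.HasAntidiagonal.mem_antidiagonal.mp hp, norm_mul]
        calc _ ≤ ‖PowerSeries.coeff p.1 f‖ * ‖PowerSeries.coeff p.2 g‖
                  * (W.w h p.1 * W.w h p.2) :=
              mul_le_mul_of_nonneg_left (W.submul h _ _) (by positivity)
          _ = _ := by ring

lemma summable_term_add {h : Set.Ioo (0 : ℝ) S} {f g : ℂ⟦X⟧} (hf : Summable (W.term h f))
    (hg : Summable (W.term h g)) : Summable (W.term h (f + g)) :=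
  Summable.of_nonneg_of_le (W.term_nonneg h _) (W.term_add_le h f g) (hf.add hg)

lemma summable_antidiagonal {h : Set.Ioo (0 : ℝ) S} {f g : ℂ⟦X⟧}
    (hf : Summable (W.term h f)) (hg : Summable (W.term h g)) :
    Summable fun j => ∑ p ∈ Finset.HasAntidiagonal.antidiagonal j, W.term h f p.1 * W.term h g p.2 :=
  summable_sum_mul_antidiagonal_of_summable_norm' hf.norm hf hg.norm hg

lemma summable_term_mul {h : Set.Ioo (0 : ℝ) S} {f g : ℂ⟦X⟧} (hf : Summable (W.term h f))
    (hg : Summable (W.term h g)) : Summable (W.term h (f * g)) :=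
  Summable.of_nonneg_of_le (W.term_nonneg h _) (W.term_mul_le h f g)
    (W.summable_antidiagonal hf hg)

lemma term_algebraMap (h : Set.Ioo (0 : ℝ) S) (c : ℂ) (j : ℕ) :
    W.term h (algebraMap ℂ ℂ⟦X⟧ c) j = if j = 0 then ‖c‖ else 0 := by
  by_cases hj : j = 0
  · subst hj
    simp [term, W.w_zero]
  · simp [term, hj, PowerSeries.coeff_C]

/-- `A_h`: the power series `∑ a_j t ^ j` with `∑ |a_j| ‖t ^ j‖_h < ∞`. -/
noncomputable def level (h : Set.Ioo (0 : ℝ) S) : Subalgebra ℂ ℂ⟦X⟧ where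
  carrier := {f | Summable (W.term h f)}
  mul_mem' := W.summable_term_mul
  add_mem' := W.summable_term_add
  algebraMap_mem' c := by
    refine summable_of_ne_finset_zero (s := {0}) fun j hj => ?_
    rw [W.term_algebraMap, if_neg (by simpa using hj)]

/-- The norm `‖∑ a_j t ^ j‖_h = ∑ |a_j| ‖t ^ j‖_h` on `A_h`. -/
noncomputable instance (h : Set.Ioo (0 : ℝ) S) : Norm (W.level h) :=
  ⟨fun f => ∑' j, W.term h f.1 j⟩

lemma norm_def {h : Set.Ioo (0 : ℝ) S} (f : W.level h) :
    ‖f‖ = ∑' j, ‖PowerSeries.coeff j f.1‖ * W.w h j := rfl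

/-- `A_h` as a normed group, with the group structure of the subalgebra. -/
noncomputable instance (h : Set.Ioo (0 : ℝ) S) : NormedAddCommGroup (W.level h) :=
  AddGroupNorm.toNormedAddCommGroup
    { toFun := fun f => ‖f‖
      map_zero' := by simp [norm_def]
      add_le' := fun f g => by
        have hf : Summable (W.term h f.1) := f.2
        have hg : Summable (W.term h g.1) := g.2
        refine le_trans (Summable.tsum_le_tsum (W.term_add_le h f.1 g.1)
          (W.summable_term_add hf hg) (hf.add hg)) (le_of_eq (hf.tsum_add hg))
      neg' := fun f => by simp [norm_def]
      eq_zero_of_map_eq_zero' := fun f hf => by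
        have hs : Summable (W.term h f.1) := f.2
        have h0 : W.term h f.1 = 0 :=
          (hs.hasSum_iff.2 hf |> (hasSum_zero_iff_of_nonneg (W.term_nonneg h f.1)).1)
        apply Subtype.ext
        ext j
        have := congrFun h0 j
        simpa [term, (W.pos h j).ne'] using this }

noncomputable instance (h : Set.Ioo (0 : ℝ) S) : NormedCommRing (W.level h) :=
  { (inferInstance : CommRing (W.level h)),
    (inferInstance : NormedAddCommGroup (W.level h)) with
    norm_mul_le := fun f g => by
      have hf : Summable (W.term h f.1) := f.2
      have hg : Summable (W.term h g.1) := g.2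
      refine le_trans (Summable.tsum_le_tsum (W.term_mul_le h f.1 g.1)
        (W.summable_term_mul hf hg) (W.summable_antidiagonal hf hg)) (le_of_eq ?_)
      exact (tsum_mul_tsum_eq_tsum_sum_antidiagonal_of_summable_norm' hf.norm hf
        hg.norm hg).symm }

noncomputable instance (h : Set.Ioo (0 : ℝ) S) : NormedAlgebra ℂ (W.level h) :=
  { (inferInstance : Algebra ℂ (W.level h)) with
    norm_smul_le := fun c f => by
      simp only [norm_def]
      rw [← tsum_mul_left]
      refine le_of_eq (tsum_congr fun j => ?_)
      simp [mul_assoc] }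

/-- `A_ĥ`, the projective limit (that is, the intersection) of the `A_l` over the levels
`l < h`. -/
noncomputable def hat (h : ℝ) : Subalgebra ℂ ℂ⟦X⟧ :=
  ⨅ (l : Set.Ioo (0 : ℝ) S) (_ : (l : ℝ) < h), W.level l

lemma hat_le_level {h : ℝ} (l : Set.Ioo (0 : ℝ) S) (hl : (l : ℝ) < h) :
    W.hat h ≤ W.level l :=
  iInf₂_le l hl

lemma hat_anti {k h : ℝ} (hkh : k ≤ h) : W.hat h ≤ W.hat k :=
  le_iInf₂ fun l hl => W.hat_le_level l (hl.trans_le hkh)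

/-- The inclusion `A_ĥ → A_l` for a level `l < h`. -/
noncomputable def toLevel {h : ℝ} (l : Set.Ioo (0 : ℝ) S) (hl : (l : ℝ) < h) : W.hat h →ₐ[ℂ] W.level l :=
  Subalgebra.inclusion (W.hat_le_level l hl)

section Stalk

variable (E : Type*) [NormedAddCommGroup E] [NormedSpace ℂ E]
  {M : Type*} [TopologicalSpace M] [ChartedSpace E M]

/-- `f : M → A_ĥ` is holomorphic on `U`: since `A_ĥ` carries the projective limit topology,
this means that `f` is holomorphic on `U` as a map to the Banach space `A_l`, for every
level `l < h`. -/
def HolomorphicOn {h : ℝ} (f : M → W.hat h) (U : Set M) : Prop :=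
  ∀ (l : Set.Ioo (0 : ℝ) S) (hl : (l : ℝ) < h),
    MDifferentiableOn 𝓘(ℂ, E) 𝓘(ℂ, W.level l) (fun y => W.toLevel l hl (f y)) U

variable {W E}

lemma HolomorphicOn.mono {h : ℝ} {f : M → W.hat h} {U V : Set M}
    (hf : W.HolomorphicOn E f U) (hVU : V ⊆ U) : W.HolomorphicOn E f V :=
  fun l hl => (hf l hl).mono hVU

lemma HolomorphicOn.add {h : ℝ} {f g : M → W.hat h} {U : Set M}
    (hf : W.HolomorphicOn E f U) (hg : W.HolomorphicOn E g U) :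
    W.HolomorphicOn E (f + g) U :=
  fun l hl => by exact (hf l hl).add (hg l hl)

lemma HolomorphicOn.neg {h : ℝ} {f : M → W.hat h} {U : Set M}
    (hf : W.HolomorphicOn E f U) : W.HolomorphicOn E (-f) U :=
  fun l hl => by exact (hf l hl).neg

lemma HolomorphicOn.mul {h : ℝ} {f g : M → W.hat h} {U : Set M}
    (hf : W.HolomorphicOn E f U) (hg : W.HolomorphicOn E g U) :
    W.HolomorphicOn E (f * g) U :=
  fun l hl => by exact (hf l hl).mul (hg l hl)

lemma HolomorphicOn.const {h : ℝ} (c : W.hat h) (U : Set M) :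
    W.HolomorphicOn E (fun _ : M => c) U :=
  fun _ _ => mdifferentiableOn_const

variable (W E)

/-- The stalk at `x` of the sheaf of holomorphic functions with values in `A_ĥ`: the ring of
germs at `x` of functions that are holomorphic on some open neighbourhood of `x`. -/
noncomputable def stalk (h : ℝ) (x : M) : Subring (Filter.Germ (𝓝 x) (W.hat h)) where
  carrier := {g | ∃ U : Set M, IsOpen U ∧ x ∈ U ∧ ∃ f : M → W.hat h,
    W.HolomorphicOn E f U ∧ (f : Filter.Germ (𝓝 x) (W.hat h)) = g}
  mul_mem' := by
    rintro _ _ ⟨U, hU, hxU, f, hf, rfl⟩ ⟨V, hV, hxV, g, hg, rfl⟩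
    exact ⟨U ∩ V, hU.inter hV, ⟨hxU, hxV⟩, f * g,
      (hf.mono Set.inter_subset_left).mul (hg.mono Set.inter_subset_right), rfl⟩
  add_mem' := by
    rintro _ _ ⟨U, hU, hxU, f, hf, rfl⟩ ⟨V, hV, hxV, g, hg, rfl⟩
    exact ⟨U ∩ V, hU.inter hV, ⟨hxU, hxV⟩, f + g,
      (hf.mono Set.inter_subset_left).add (hg.mono Set.inter_subset_right), rfl⟩
  neg_mem' := by
    rintro _ ⟨U, hU, hxU, f, hf, rfl⟩
    exact ⟨U, hU, hxU, -f, hf.neg, rfl⟩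
  one_mem' := ⟨Set.univ, isOpen_univ, trivial, fun _ => 1, .const 1 _, rfl⟩
  zero_mem' := ⟨Set.univ, isOpen_univ, trivial, fun _ => 0, .const 0 _, rfl⟩

/-- For `k ≤ h`, the ring homomorphism on germs of functions induced by `A_ĥ ⊆ A_k̂`. -/
noncomputable def germMap {k h : ℝ} (hkh : k ≤ h) (x : M) :
    Filter.Germ (𝓝 x) (W.hat h) →+* Filter.Germ (𝓝 x) (W.hat k) where
  toFun := Filter.Germ.map (Subalgebra.inclusion (W.hat_anti hkh))
  map_one' := rfl
  map_zero' := rfl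
  map_add' a b := Filter.Germ.inductionOn₂ a b fun _ _ => rfl
  map_mul' a b := Filter.Germ.inductionOn₂ a b fun _ _ => rfl

/-- For `k ≤ h`, the ring homomorphism of stalks induced by the inclusion `A_ĥ ⊆ A_k̂`. -/
noncomputable def stalkMap {k h : ℝ} (hkh : k ≤ h) (x : M) : W.stalk E h x →+* W.stalk E k x :=
  (W.germMap hkh x).restrict (W.stalk E h x) (W.stalk E k x) <| by
    rintro _ ⟨U, hU, hxU, f, hf, rfl⟩
    exact ⟨U, hU, hxU, fun y => Subalgebra.inclusion (W.hat_anti hkh) (f y),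
      fun l hl => hf l (hl.trans_le hkh), rfl⟩

end Stalk

end WeightFamily

/-! In coordinates centred at `x`, the stalk is the ring `W.conv n h` of power series in t, z₁, …,
z_n whose weighted ℓ¹ norms at all levels l < h are finite on one polydisc in z, independent of l
(`convEquiv`). Cauchy's estimates only bound the Taylor coefficients of an A_ĥ-valued function at
each level; controlled nuclearity, applied twice, gains a factor j⁻² on passing to a lower level and
so makes the ℓ¹ norms finite.

Each `W.conv n h` is a Noetherian local ring with residue field ℂ, and its maximal ideal is
generated by the variables. The N-th power of this ideal consists of the series of order at least N,
a condition that does not mention h. Hence `W.conv n h → W.conv n k` is an isomorphism modulo every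
power of the maximal ideal. By Artin–Rees and Krull's intersection theorem such a map is flat
(`flat_of_forall_comap_map_pow_le`); being local, it is faithfully flat.

The hard part is Noetherianity (`isNoetherianRing_conv`), by induction on n through Weierstrass
division. The division has to work on a polydisc that does not shrink with l. Locality makes t
quasinilpotent, so each level norm has an equivalent one for which t is as small as desired. The
terms involving t are then a negligible perturbation, and the polydisc is dictated by the t-free
part of the divisor alone (`exists_division_of_wnorm_lt`). Division settles the ideals that contain
a series not divisible by t; a prime without such a series is 0 or (t), and by Cohen's theorem
primes suffice. -/

open scoped ENNReal NNReal

/-! ### Weighted ℓ¹ norms of power series -/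

section WeightedNorm

variable {σ : Type*}

/-- The weighted `ℓ¹` norm `∑ |f_d| v_d` of a power series, with values in `[0, ∞]`. -/
noncomputable def wnorm (v : (σ →₀ ℕ) → ℝ≥0) (f : MvPowerSeries σ ℂ) : ℝ≥0∞ :=
  ∑' d, ‖MvPowerSeries.coeff d f‖ₑ * v d

lemma coeff_le_wnorm (v : (σ →₀ ℕ) → ℝ≥0) (f : MvPowerSeries σ ℂ) (d : σ →₀ ℕ) :
    ‖MvPowerSeries.coeff d f‖ₑ * v d ≤ wnorm v f :=
  ENNReal.le_tsum d

@[simp] lemma wnorm_zero (v : (σ →₀ ℕ) → ℝ≥0) : wnorm v 0 = 0 := by simp [wnorm]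

@[simp] lemma wnorm_neg (v : (σ →₀ ℕ) → ℝ≥0) (f : MvPowerSeries σ ℂ) :
    wnorm v (-f) = wnorm v f := by simp [wnorm]

lemma wnorm_add_le (v : (σ →₀ ℕ) → ℝ≥0) (f g : MvPowerSeries σ ℂ) :
    wnorm v (f + g) ≤ wnorm v f + wnorm v g := by
  unfold wnorm
  rw [← ENNReal.tsum_add]
  refine ENNReal.tsum_le_tsum fun d => ?_
  rw [map_add, ← add_mul]
  gcongr
  exact enorm_add_le _ _

lemma wnorm_sub_le (v : (σ →₀ ℕ) → ℝ≥0) (f g : MvPowerSeries σ ℂ) :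
    wnorm v (f - g) ≤ wnorm v f + wnorm v g := by
  simpa [sub_eq_add_neg] using wnorm_add_le v f (-g)

/-- With values in `[0, ∞]` the double sum over antidiagonals may be rearranged without any
summability condition. -/
lemma wnorm_mul_le {v : (σ →₀ ℕ) → ℝ≥0} (hv : ∀ d e, v (d + e) ≤ v d * v e)
    (f g : MvPowerSeries σ ℂ) : wnorm v (f * g) ≤ wnorm v f * wnorm v g := by
  classical
  let F : (σ →₀ ℕ) → ℝ≥0∞ := fun d => ‖MvPowerSeries.coeff d f‖ₑ * v d
  let G : (σ →₀ ℕ) → ℝ≥0∞ := fun d => ‖MvPowerSeries.coeff d g‖ₑ * v d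
  have h1 : ∀ d, ‖MvPowerSeries.coeff d (f * g)‖ₑ * v d ≤
      ∑ p ∈ Finset.HasAntidiagonal.antidiagonal d, F p.1 * G p.2 := by
    intro d
    rw [MvPowerSeries.coeff_mul]
    calc _ ≤ (∑ p ∈ Finset.HasAntidiagonal.antidiagonal d,
          ‖MvPowerSeries.coeff p.1 f * MvPowerSeries.coeff p.2 g‖ₑ) * v d := by
          gcongr; exact enorm_sum_le _ _
      _ ≤ _ := by
          rw [Finset.sum_mul]
          refine Finset.sum_le_sum fun p hp => ?_
          rw [← Finset.HasAntidiagonal.mem_antidiagonal.1 hp, enorm_mul]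
          calc _ ≤ ‖MvPowerSeries.coeff p.1 f‖ₑ * ‖MvPowerSeries.coeff p.2 g‖ₑ *
                (v p.1 * v p.2 : ℝ≥0) := by gcongr; exact hv _ _
            _ = _ := by push_cast; ring
  calc wnorm v (f * g) ≤ ∑' d, ∑ p ∈ Finset.HasAntidiagonal.antidiagonal d, F p.1 * G p.2 :=
        ENNReal.tsum_le_tsum h1
    _ = ∑' d, ∑' p : Finset.HasAntidiagonal.antidiagonal d, F p.1.1 * G p.1.2 := by
        congr 1; ext d
        rw [Finset.tsum_subtype (Finset.HasAntidiagonal.antidiagonal d) (fun p => F p.1 * G p.2)]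
    _ = ∑' p : (Σ d : σ →₀ ℕ, Finset.HasAntidiagonal.antidiagonal d), F p.2.1.1 * G p.2.1.2 :=
        (ENNReal.tsum_sigma' (fun p : (Σ d : σ →₀ ℕ, Finset.HasAntidiagonal.antidiagonal d) =>
          F p.2.1.1 * G p.2.1.2)).symm
    _ = ∑' p : (σ →₀ ℕ) × (σ →₀ ℕ), F p.1 * G p.2 :=
        (Finset.HasAntidiagonal.sigmaAntidiagonalEquivProd (A := σ →₀ ℕ)).tsum_eq
          (fun p : (σ →₀ ℕ) × (σ →₀ ℕ) => F p.1 * G p.2)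
    _ = wnorm v f * wnorm v g := by
        rw [ENNReal.tsum_prod', wnorm, wnorm, ← ENNReal.tsum_mul_right]
        refine tsum_congr fun a => ?_
        simp only [F, G, ENNReal.tsum_mul_left]

/-- The common form of the norm estimates: `s` is a translation of exponents when dividing by a
monomial, and the identity when comparing weights. -/
lemma wnorm_le_of_coeff_le {v v' : (σ →₀ ℕ) → ℝ≥0} {f g : MvPowerSeries σ ℂ}
    {C : ℝ≥0} (s : (σ →₀ ℕ) → (σ →₀ ℕ)) (hs : Function.Injective s)
    (h : ∀ d, MvPowerSeries.coeff d f ≠ 0 → ‖MvPowerSeries.coeff d f‖ₑ * v d ≤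
      C * (‖MvPowerSeries.coeff (s d) g‖ₑ * v' (s d))) :
    wnorm v f ≤ C * wnorm v' g := by
  calc wnorm v f ≤ ∑' d, C * (‖MvPowerSeries.coeff (s d) g‖ₑ * v' (s d)) := by
        refine ENNReal.tsum_le_tsum fun d => ?_
        by_cases hd : MvPowerSeries.coeff d f = 0
        · simp [hd]
        · exact h d hd
    _ = C * ∑' d, (‖MvPowerSeries.coeff (s d) g‖ₑ * v' (s d)) := ENNReal.tsum_mul_left
    _ ≤ C * wnorm v' g := by
        gcongr
        exact ENNReal.tsum_comp_le_tsum_of_injective hs _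

lemma wnorm_le_mul_wnorm {v v' : (σ →₀ ℕ) → ℝ≥0} {f : MvPowerSeries σ ℂ} {C : ℝ≥0}
    (h : ∀ d, MvPowerSeries.coeff d f ≠ 0 → v d ≤ C * v' d) :
    wnorm v f ≤ C * wnorm v' f :=
  wnorm_le_of_coeff_le id Function.injective_id fun d hd => by
    calc _ ≤ ‖MvPowerSeries.coeff d f‖ₑ * (C * v' d : ℝ≥0) := by gcongr; exact h d hd
      _ = _ := by push_cast; simp only [id]; ring

lemma wnorm_mono {v v' : (σ →₀ ℕ) → ℝ≥0} (h : v ≤ v') (f : MvPowerSeries σ ℂ) :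
    wnorm v f ≤ wnorm v' f := by
  simpa using wnorm_le_mul_wnorm (C := 1) (f := f) fun d _ => by simpa using h d

lemma wnorm_one_le (v : (σ →₀ ℕ) → ℝ≥0) : wnorm v 1 ≤ v 0 := by
  classical
  unfold wnorm
  rw [tsum_eq_single 0]
  · simp
  · intro d hd; simp [MvPowerSeries.coeff_one, hd]

lemma wnorm_monomial (v : (σ →₀ ℕ) → ℝ≥0) (e : σ →₀ ℕ) (c : ℂ) :
    wnorm v (MvPowerSeries.monomial e c) = ‖c‖ₑ * v e := by
  classical
  unfold wnorm
  rw [tsum_eq_single e]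
  · simp
  · intro d hd; simp [MvPowerSeries.coeff_monomial, hd]

end WeightedNorm

/-- The weights `u_j ρ ^ α` for the exponent `(j, α)`. -/
noncomputable def wt {n : ℕ} (u : ℕ → ℝ≥0) (ρ : Fin n → ℝ≥0) (d : Fin (n + 1) →₀ ℕ) : ℝ≥0 :=
  u (d 0) * ∏ i : Fin n, ρ i ^ d i.succ

section wt

variable {n : ℕ} {u : ℕ → ℝ≥0} {ρ ρ' : Fin n → ℝ≥0}

lemma wt_add_le (hu : ∀ i j, u (i + j) ≤ u i * u j) (d e : Fin (n + 1) →₀ ℕ) :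
    wt u ρ (d + e) ≤ wt u ρ d * wt u ρ e := by
  unfold wt
  simp only [Finsupp.add_apply, pow_add, Finset.prod_mul_distrib]
  calc _ ≤ (u (d 0) * u (e 0)) * ((∏ i, ρ i ^ d i.succ) * ∏ i, ρ i ^ e i.succ) := by
        gcongr; exact hu _ _
    _ = _ := by ring

lemma wt_mono_right (h : ρ ≤ ρ') : wt u ρ ≤ wt u ρ' := fun d => by
  unfold wt
  gcongr with i
  exact h i

lemma wt_mono_left {u' : ℕ → ℝ≥0} (h : u ≤ u') : wt u ρ ≤ wt u' ρ := fun d => by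
  unfold wt
  gcongr
  exact h _

lemma wt_pos (hu : ∀ j, 0 < u j) (hρ : ∀ i, 0 < ρ i) (d : Fin (n + 1) →₀ ℕ) : 0 < wt u ρ d :=
  mul_pos (hu _) (Finset.prod_pos fun i _ => pow_pos (hρ i) _)

/-- Exact multiplicativity, and not just the inequality of `wt_add_le`, makes division by the
monomial `e` cost precisely the inverse of its norm. -/
lemma wt_add_of_zero (d e : Fin (n + 1) →₀ ℕ) (he : e 0 = 0) (hu : u 0 = 1) :
    wt u ρ (d + e) = wt u ρ d * wt u ρ e := by
  simp [wt, he, hu, pow_add, Finset.prod_mul_distrib, mul_assoc]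

lemma wt_add_single_succ (d : Fin (n + 1) →₀ ℕ) (i : Fin n) :
    wt u ρ (d + Finsupp.single i.succ 1) = wt u ρ d * ρ i := by
  have h : ∏ j : Fin n, ρ j ^ (Finsupp.single i.succ 1 : Fin (n + 1) →₀ ℕ) j.succ = ρ i := by
    rw [Finset.prod_eq_single i]
    · simp
    · intro j _ hj
      simp [hj]
    · simp
  simp only [wt, Finsupp.add_apply, pow_add, Finset.prod_mul_distrib, h]
  simp [mul_assoc]

lemma wt_add_single_zero (d : Fin (n + 1) →₀ ℕ) :
    wt u ρ (d + Finsupp.single 0 1) = u (d 0 + 1) * ∏ i : Fin n, ρ i ^ d i.succ := by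
  simp [wt]

end wt

/-! ### The ring of convergent power series -/

namespace WeightFamily

variable {S : ℝ} (W : WeightFamily S)

/-- The weights as nonnegative reals. -/
noncomputable def u (l : Set.Ioo (0 : ℝ) S) (j : ℕ) : ℝ≥0 := (W.w l j).toNNReal

@[simp] lemma coe_u (l : Set.Ioo (0 : ℝ) S) (j : ℕ) : (W.u l j : ℝ) = W.w l j :=
  Real.coe_toNNReal _ (W.pos l j).le

lemma u_pos (l : Set.Ioo (0 : ℝ) S) (j : ℕ) : 0 < W.u l j :=
  Real.toNNReal_pos.2 (W.pos l j)

lemma u_add_le (l : Set.Ioo (0 : ℝ) S) (i j : ℕ) : W.u l (i + j) ≤ W.u l i * W.u l j := by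
  simpa [← NNReal.coe_le_coe] using W.submul l i j

@[simp] lemma u_zero (l : Set.Ioo (0 : ℝ) S) : W.u l 0 = 1 :=
  NNReal.eq (by simpa using W.w_zero l)

/-- Power series in `t` and `z₁, …, z_n` that converge on a polydisc in `z`, independent of the
level `l < h`, with respect to all the norms of levels `l < h`. -/
def conv (n : ℕ) (h : ℝ) : Subring (MvPowerSeries (Fin (n + 1)) ℂ) where
  carrier := {f | ∃ ρ : Fin n → ℝ≥0, (∀ i, 0 < ρ i) ∧
    ∀ l : Set.Ioo (0 : ℝ) S, (l : ℝ) < h → wnorm (wt (W.u l) ρ) f < ⊤}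
  mul_mem' := by
    rintro f g ⟨ρ, hρ, hf⟩ ⟨ρ', hρ', hg⟩
    refine ⟨ρ ⊓ ρ', fun i => lt_min (hρ i) (hρ' i), fun l hl => ?_⟩
    refine (wnorm_mul_le (wt_add_le (W.u_add_le l)) f g).trans_lt (ENNReal.mul_lt_top ?_ ?_)
    · exact (wnorm_mono (wt_mono_right inf_le_left) f).trans_lt (hf l hl)
    · exact (wnorm_mono (wt_mono_right inf_le_right) g).trans_lt (hg l hl)
  add_mem' := by
    rintro f g ⟨ρ, hρ, hf⟩ ⟨ρ', hρ', hg⟩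
    refine ⟨ρ ⊓ ρ', fun i => lt_min (hρ i) (hρ' i), fun l hl => ?_⟩
    refine (wnorm_add_le _ f g).trans_lt (ENNReal.add_lt_top.2 ⟨?_, ?_⟩)
    · exact (wnorm_mono (wt_mono_right inf_le_left) f).trans_lt (hf l hl)
    · exact (wnorm_mono (wt_mono_right inf_le_right) g).trans_lt (hg l hl)
  neg_mem' := by
    rintro f ⟨ρ, hρ, hf⟩
    exact ⟨ρ, hρ, fun l hl => by simpa using hf l hl⟩
  one_mem' := ⟨1, fun _ => one_pos, fun l _ => (wnorm_one_le _).trans_lt ENNReal.coe_lt_top⟩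
  zero_mem' := ⟨1, fun _ => one_pos, fun l _ => by simp⟩

variable {W} {n : ℕ} {h : ℝ}

lemma monomial_mem_conv (e : Fin (n + 1) →₀ ℕ) (c : ℂ) :
    MvPowerSeries.monomial e c ∈ W.conv n h :=
  ⟨1, fun _ => one_pos, fun l _ => by
    rw [wnorm_monomial]; exact ENNReal.mul_lt_top (by simp) ENNReal.coe_lt_top⟩

lemma X_mem_conv (i : Fin (n + 1)) : (MvPowerSeries.X i : MvPowerSeries (Fin (n + 1)) ℂ) ∈
    W.conv n h := monomial_mem_conv _ _

lemma C_mem_conv (c : ℂ) : (MvPowerSeries.C c : MvPowerSeries (Fin (n + 1)) ℂ) ∈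
    W.conv n h := monomial_mem_conv 0 c

lemma conv_anti {k : ℝ} (hkh : k ≤ h) : W.conv n h ≤ W.conv n k := by
  rintro f ⟨ρ, hρ, hf⟩
  exact ⟨ρ, hρ, fun l hl => hf l (hl.trans_le hkh)⟩

lemma exists_level_between (hh : h ≤ S) (l : Set.Ioo (0 : ℝ) S)
    (hl : (l : ℝ) < h) : ∃ l' : Set.Ioo (0 : ℝ) S, l < l' ∧ (l' : ℝ) < h := by
  obtain ⟨m, h1, h2⟩ := exists_between hl
  exact ⟨⟨m, l.2.1.trans h1, h2.trans_le hh⟩, h1, h2⟩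

/-- Passing to a higher level absorbs the loss caused by dividing by `t`. -/
lemma exists_u_le_mul_u_succ (W : WeightFamily S) {l l' : Set.Ioo (0 : ℝ) S} (hl : l < l') :
    ∃ K : ℝ≥0, ∀ j, W.u l j ≤ K * W.u l' (j + 1) := by
  obtain ⟨K, hK, h⟩ := W.nuclearity l l' hl
  lift K to ℝ≥0 using hK.le
  -- Nuclearity is silent about `j = 0`; the second summand covers that case, as `W.u l 0 = 1`.
  refine ⟨K + (W.u l' 1)⁻¹, fun j => ?_⟩
  rw [add_mul]
  rcases Nat.eq_zero_or_pos j with rfl | hj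
  · refine le_trans ?_ le_add_self
    simp [inv_mul_cancel₀ (W.u_pos l' 1).ne']
  · refine le_trans ?_ le_self_add
    rw [← NNReal.coe_le_coe]
    have hp := W.pos l' j
    push_cast
    simp only [coe_u]
    calc W.w l j ≤ K * min ((j : ℝ)⁻¹) (W.w l' (j + 1) / W.w l' j) * W.w l' j := h j hj
      _ ≤ K * (W.w l' (j + 1) / W.w l' j) * W.w l' j := by gcongr; exact min_le_right _ _
      _ = K * W.w l' (j + 1) := by field_simp

/-- Dividing by a variable, on some of the coefficients. -/
lemma shift_mem_conv (hh : h ≤ S) {f g : MvPowerSeries (Fin (n + 1)) ℂ} (hf : f ∈ W.conv n h)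
    (i : Fin (n + 1)) (hg : ∀ d, MvPowerSeries.coeff d g ≠ 0 →
      MvPowerSeries.coeff d g = MvPowerSeries.coeff (d + Finsupp.single i 1) f) :
    g ∈ W.conv n h := by
  obtain ⟨ρ, hρ, hf⟩ := hf
  refine ⟨ρ, hρ, fun l hl => ?_⟩
  obtain ⟨l', hll', hl'⟩ := exists_level_between hh l hl
  obtain ⟨C, hC⟩ : ∃ C : ℝ≥0, ∀ d, wt (W.u l) ρ d ≤
      C * wt (W.u l') ρ (d + Finsupp.single i 1) := by
    obtain ⟨K, hK⟩ := W.exists_u_le_mul_u_succ hll'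
    cases i using Fin.cases with
    | zero =>
      refine ⟨K, fun d => ?_⟩
      rw [wt_add_single_zero, ← mul_assoc, wt]
      gcongr
      exact hK _
    | succ i =>
      -- Dividing by z_i costs `(ρ i)⁻¹`; the other factors only compare the level `l` with the
      -- level `l'`.
      refine ⟨K * W.u l' 1 * (ρ i)⁻¹, fun d => ?_⟩
      have h1 : W.u l (d 0) ≤ K * W.u l' 1 * W.u l' (d 0) := (hK _).trans <| by
        rw [mul_assoc, add_comm]; gcongr; exact W.u_add_le _ _ _
      rw [wt_add_single_succ, wt, wt]
      calc _ ≤ K * W.u l' 1 * W.u l' (d 0) * ∏ i : Fin n, ρ i ^ d i.succ := by gcongr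
        _ = _ := by have := (hρ i).ne'; field_simp
  refine lt_of_le_of_lt (wnorm_le_of_coeff_le (C := C) (v' := wt (W.u l') ρ)
    (fun d => d + Finsupp.single i 1) (add_left_injective _) (g := f) fun d hd => ?_)
    (ENNReal.mul_lt_top ENNReal.coe_lt_top (hf l' hl'))
  rw [hg d hd]
  calc _ ≤ ‖MvPowerSeries.coeff (d + Finsupp.single i 1) f‖ₑ *
        ((C * wt (W.u l') ρ (d + Finsupp.single i 1) : ℝ≥0) : ℝ≥0∞) := by gcongr; exact hC d
    _ = _ := by push_cast; ring

end WeightFamily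

/-! ### Division by a small perturbation of a monomial -/

section Division

variable {σ : Type*}

/-- The part of `f` divisible by the monomial `e`, divided by it. -/
noncomputable def shift (e : σ →₀ ℕ) (f : MvPowerSeries σ ℂ) : MvPowerSeries σ ℂ :=
  fun d => MvPowerSeries.coeff (d + e) f

@[simp] lemma coeff_shift (e d : σ →₀ ℕ) (f : MvPowerSeries σ ℂ) :
    MvPowerSeries.coeff d (shift e f) = MvPowerSeries.coeff (d + e) f := rfl

lemma wnorm_shift_le {v : (σ →₀ ℕ) → ℝ≥0} {e : σ →₀ ℕ} (hpos : 0 < v e)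
    (he : ∀ d, v (d + e) = v d * v e) (f : MvPowerSeries σ ℂ) :
    wnorm v (shift e f) ≤ (v e)⁻¹ * wnorm v f := by
  refine wnorm_le_of_coeff_le (fun d => d + e) (add_left_injective e) fun d _ => ?_
  rw [coeff_shift, he]
  have : v d = (v e)⁻¹ * (v d * v e) := by field_simp
  nth_rw 1 [this]
  push_cast
  exact le_of_eq (by ring)

/-- Write g = X^e + r. The vanishing of the coefficients of f - q g at all d + e means q = `shift e
f` - `shift e (r * q)`. The smallness of r makes q ↦ `shift e (r * q)` a contraction for each norm
`v i`, and q is the sum of the Neumann series. Its terms do not involve i, so a single q serves all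
the norms, whatever their rates θ i of convergence. -/
lemma exists_division {ι : Type*} [Nonempty ι] (e : σ →₀ ℕ) (f g : MvPowerSeries σ ℂ)
    (v : ι → (σ →₀ ℕ) → ℝ≥0) (hpos : ∀ i d, 0 < v i d)
    (hv : ∀ i d d', v i (d + d') ≤ v i d * v i d')
    (he : ∀ i d, v i (d + e) = v i d * v i e)
    (hlt : ∀ i, wnorm (v i) (g - MvPowerSeries.monomial e 1) < v i e)
    (hf : ∀ i, wnorm (v i) f < ⊤) :
    ∃ q, (∀ d, MvPowerSeries.coeff (d + e) (f - q * g) = 0) ∧ ∀ i, wnorm (v i) q < ⊤ := by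
  classical
  set r := g - MvPowerSeries.monomial e 1 with hr
  let a : ℕ → MvPowerSeries σ ℂ := fun N => N.rec (shift e f) fun _ b => -shift e (r * b)
  have a_zero : a 0 = shift e f := rfl
  have a_succ : ∀ N, a (N + 1) = -shift e (r * a N) := fun _ => rfl
  let θ : ι → ℝ≥0∞ := fun i => (v i e)⁻¹ * wnorm (v i) r
  have hθ : ∀ i, θ i < 1 := fun i => by
    have h0 : (v i e : ℝ≥0∞) ≠ 0 := by simpa using (hpos i e).ne'
    have h1 : θ i = wnorm (v i) r / v i e := by
      simp only [θ]
      rw [ENNReal.coe_inv (hpos i e).ne', mul_comm, ← div_eq_mul_inv]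
    rw [h1, ENNReal.div_lt_iff (Or.inl h0) (Or.inl ENNReal.coe_ne_top)]
    simpa using hlt i
  have ha : ∀ i N, wnorm (v i) (a N) ≤ θ i ^ N * wnorm (v i) (a 0) := by
    intro i N
    induction N with
    | zero => simp
    | succ N ih =>
      rw [a_succ, wnorm_neg]
      calc _ ≤ (v i e)⁻¹ * wnorm (v i) (r * a N) := wnorm_shift_le (hpos i e) (he i) _
        _ ≤ (v i e)⁻¹ * (wnorm (v i) r * wnorm (v i) (a N)) := by
            gcongr; exact wnorm_mul_le (hv i) _ _
        _ ≤ (v i e)⁻¹ * (wnorm (v i) r * (θ i ^ N * wnorm (v i) (a 0))) := by gcongr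
        _ = _ := by simp only [θ, pow_succ]; ring
  have hsum : ∀ i, ∑' N, wnorm (v i) (a N) < ⊤ := fun i => by
    have h0 : wnorm (v i) (a 0) < ⊤ :=
      (wnorm_shift_le (hpos i e) (he i) f).trans_lt (ENNReal.mul_lt_top
        ENNReal.coe_lt_top (hf i))
    refine (ENNReal.tsum_le_tsum (ha i)).trans_lt ?_
    rw [ENNReal.tsum_mul_right, ENNReal.tsum_geometric]
    refine ENNReal.mul_lt_top ?_ h0
    simpa using hθ i
  have hS : ∀ d, Summable fun N => MvPowerSeries.coeff d (a N) := fun d => by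
    obtain ⟨i⟩ := ‹Nonempty ι›
    have h1 : ∑' N, ‖MvPowerSeries.coeff d (a N)‖ₑ * v i d < ⊤ :=
      (ENNReal.tsum_le_tsum fun N => coeff_le_wnorm (v i) (a N) d).trans_lt (hsum i)
    rw [ENNReal.tsum_mul_right] at h1
    have h2 : ∑' N, ‖MvPowerSeries.coeff d (a N)‖ₑ ≠ ⊤ := fun h => by
      rw [h, ENNReal.top_mul (by simpa using (hpos i d).ne')] at h1
      exact lt_irrefl _ h1
    rw [← summable_norm_iff]
    have := (ENNReal.summable_toReal h2)
    simpa using this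
  let q : MvPowerSeries σ ℂ := fun d => ∑' N, MvPowerSeries.coeff d (a N)
  have hq : ∀ d, MvPowerSeries.coeff d q = ∑' N, MvPowerSeries.coeff d (a N) := fun d => rfl
  refine ⟨q, fun d => ?_, fun i => ?_⟩
  · have hg : q * g = MvPowerSeries.monomial e 1 * q + r * q := by rw [hr]; ring
    have h1 : MvPowerSeries.coeff (d + e) (r * q) =
        ∑' N, MvPowerSeries.coeff (d + e) (r * a N) := by
      simp only [MvPowerSeries.coeff_mul, hq]
      rw [Summable.tsum_finsetSum fun p _ => (hS _).mul_left _]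
      simp_rw [tsum_mul_left]
    have h2 : ∀ N, MvPowerSeries.coeff (d + e) (r * a N) = -MvPowerSeries.coeff d (a (N + 1)) :=
      fun N => by simp [a_succ]
    rw [hg, map_sub, map_add, h1, add_comm d e, MvPowerSeries.coeff_add_monomial_mul, hq,
      (hS d).tsum_eq_zero_add]
    simp_rw [add_comm e d, h2, tsum_neg]
    simp [a_zero]
  · refine lt_of_le_of_lt ?_ (hsum i)
    unfold wnorm
    rw [ENNReal.tsum_comm]
    refine ENNReal.tsum_le_tsum fun d => ?_
    rw [ENNReal.tsum_mul_right, hq]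
    gcongr
    exact enorm_tsum_le_tsum_enorm

end Division

/-! ### Weierstrass division at all levels simultaneously -/

namespace WeightFamily

variable {S : ℝ} {W : WeightFamily S}

/-- Locality: `t` is quasinilpotent. -/
lemma exists_u_le_mul_pow (l : Set.Ioo (0 : ℝ) S) {δ : ℝ≥0} (hδ : 0 < δ) :
    ∃ C : ℝ≥0, ∀ j, W.u l j ≤ C * δ ^ j := by
  have hne : ∀ j, W.w l j / (δ : ℝ) ^ j ≠ 0 := fun j =>
    div_ne_zero (W.pos l j).ne' (pow_ne_zero _ (by exact_mod_cast hδ.ne'))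
  have hs : Summable fun j => W.w l j / (δ : ℝ) ^ j := by
    refine summable_of_ratio_test_tendsto_lt_one (l := 0) one_pos (.of_forall hne) ?_
    have h1 := (W.locality l).div_const (δ : ℝ)
    rw [zero_div] at h1
    refine h1.congr fun j => ?_
    have hp := W.pos l j
    have hp' := W.pos l (j + 1)
    have hδ' : (0 : ℝ) < δ := hδ
    rw [Real.norm_of_nonneg (by positivity), Real.norm_of_nonneg (by positivity)]
    field_simp
    ring
  refine ⟨(∑' j, W.w l j / (δ : ℝ) ^ j).toNNReal, fun j => ?_⟩
  have h0 : ∀ j, 0 ≤ W.w l j / (δ : ℝ) ^ j := fun j => div_nonneg (W.pos l j).le (by positivity)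
  rw [← NNReal.coe_le_coe, NNReal.coe_mul, Real.coe_toNNReal _ (tsum_nonneg h0), coe_u,
    NNReal.coe_pow, ← div_le_iff₀ (by positivity)]
  exact hs.le_tsum j fun i _ => h0 i

/-- An equivalent system of weights for which `t` is small. -/
lemma exists_equivalent_weight (l : Set.Ioo (0 : ℝ) S) {δ : ℝ≥0} (hδ : 0 < δ) :
    ∃ u' : ℕ → ℝ≥0, (∀ j, 0 < u' j) ∧ (∀ i j, u' (i + j) ≤ u' i * u' j) ∧ u' 0 = 1 ∧
      u' ≤ W.u l ∧ (∀ j, u' (j + 1) ≤ δ * W.u l j) ∧ ∃ C : ℝ≥0, ∀ j, W.u l j ≤ C * u' j := by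
  -- The new weight of t^j is the cheapest way of splitting t^j = t^a t^b and charging δ^a for the
  -- first factor and the old weight for the second. Splittings add up, which gives
  -- submultiplicativity; the splittings (0, j) and (1, j) give the two upper bounds. Equivalence
  -- holds because `W.u l a` is O(δ^a) by locality.
  let F : ℕ × ℕ → ℝ≥0 := fun p => δ ^ p.1 * W.u l p.2
  have hne : ∀ j : ℕ, (Finset.HasAntidiagonal.antidiagonal j).Nonempty := fun j =>
    ⟨(0, j), by simp⟩
  let u' : ℕ → ℝ≥0 := fun j => (Finset.HasAntidiagonal.antidiagonal j).inf' (hne j) F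
  have hle : ∀ i j, u' (i + j) ≤ F (i, j) := fun i j => Finset.inf'_le F (by simp)
  have hex : ∀ j, ∃ p : ℕ × ℕ, p.1 + p.2 = j ∧ u' j = F p := fun j => by
    obtain ⟨p, hp, h⟩ := Finset.exists_mem_eq_inf' (hne j) F
    exact ⟨p, by simpa using hp, h⟩
  have hF : ∀ p, 0 < F p := fun p => mul_pos (pow_pos hδ _) (W.u_pos l _)
  refine ⟨u', fun j => ?_, fun i j => ?_, ?_, fun j => ?_, fun j => ?_, ?_⟩
  · obtain ⟨p, -, h⟩ := hex j
    exact h ▸ hF p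
  · obtain ⟨p, rfl, hp⟩ := hex i
    obtain ⟨q, rfl, hq⟩ := hex j
    rw [hp, hq, add_add_add_comm]
    refine (hle _ _).trans ?_
    simp only [F, pow_add]
    calc _ ≤ δ ^ p.1 * δ ^ q.1 * (W.u l p.2 * W.u l q.2) := by gcongr; exact W.u_add_le l _ _
      _ = _ := by ring
  · obtain ⟨p, hp, h⟩ := hex 0
    obtain ⟨h1, h2⟩ := Nat.add_eq_zero_iff.1 hp
    simp [h, F, h1, h2]
  · simpa [F] using hle 0 j
  · simpa [F, add_comm] using hle 1 j
  · obtain ⟨C, hC⟩ := exists_u_le_mul_pow (W := W) l hδ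
    refine ⟨C, fun j => ?_⟩
    obtain ⟨p, rfl, hp⟩ := hex j
    rw [hp]
    calc _ ≤ W.u l p.1 * W.u l p.2 := W.u_add_le l _ _
      _ ≤ C * δ ^ p.1 * W.u l p.2 := by gcongr; exact hC _
      _ = _ := by simp only [F]; ring

variable {n : ℕ} {h : ℝ}

/-- The part of `g` not involving `t`. -/
noncomputable def constPart (g : MvPowerSeries (Fin (n + 1)) ℂ) : MvPowerSeries (Fin (n + 1)) ℂ :=
  fun d => if d 0 = 0 then MvPowerSeries.coeff d g else 0

lemma coeff_constPart (g : MvPowerSeries (Fin (n + 1)) ℂ) (d : Fin (n + 1) →₀ ℕ) :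
    MvPowerSeries.coeff d (constPart g) = if d 0 = 0 then MvPowerSeries.coeff d g else 0 := rfl

/-- The smallness condition `hlt` involves only the t-free part of g, hence no level, so the same ρ
serves all l < h. At each level the terms with t are made harmless by an equivalent weight, whose δ
may depend on l, and finiteness of norms is insensitive to this change. -/
lemma exists_division_of_wnorm_lt (hh0 : 0 < h) (hh : h ≤ S) {e : Fin (n + 1) →₀ ℕ} (he : e 0 = 0)
    {ρ : Fin n → ℝ≥0} (hρ : ∀ i, 0 < ρ i) {f g : MvPowerSeries (Fin (n + 1)) ℂ}
    (hf : ∀ l : Set.Ioo (0 : ℝ) S, (l : ℝ) < h → wnorm (wt (W.u l) ρ) f < ⊤)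
    (hg : ∀ l : Set.Ioo (0 : ℝ) S, (l : ℝ) < h → wnorm (wt (W.u l) ρ) g < ⊤)
    (hlt : wnorm (wt 1 ρ) (constPart g - MvPowerSeries.monomial e 1) < wt 1 ρ e) :
    ∃ q ∈ W.conv n h, ∀ d, MvPowerSeries.coeff (d + e) (f - q * g) = 0 := by
  classical
  set a := constPart g - MvPowerSeries.monomial e 1 with ha
  have ha0 : ∀ d : Fin (n + 1) →₀ ℕ, MvPowerSeries.coeff d a ≠ 0 → d 0 = 0 := by
    intro d hd
    by_contra h0
    have hde : d ≠ e := fun hde => h0 (hde ▸ he)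
    simp [ha, coeff_constPart, h0, MvPowerSeries.coeff_monomial, hde] at hd
  have key : ∀ l : {l : Set.Ioo (0 : ℝ) S // (l : ℝ) < h}, ∃ u' : ℕ → ℝ≥0, (∀ j, 0 < u' j) ∧
      (∀ i j, u' (i + j) ≤ u' i * u' j) ∧ u' 0 = 1 ∧ u' ≤ W.u l.1 ∧
      (∃ C : ℝ≥0, ∀ j, W.u l.1 j ≤ C * u' j) ∧
      wnorm (wt u' ρ) (g - MvPowerSeries.monomial e 1) < wt u' ρ e := by
    rintro ⟨l, hl⟩
    obtain ⟨l', hll', hl'⟩ := exists_level_between hh l hl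
    obtain ⟨K, hK⟩ := W.exists_u_le_mul_u_succ hll'
    set M := K * wnorm (wt (W.u l') ρ) g with hM
    have hMtop : M ≠ ⊤ := (ENNReal.mul_lt_top ENNReal.coe_lt_top (hg l' hl')).ne
    -- The room left by `hlt` is the bound for the t-part of g: there `u' (j + 1) ≤ δ * W.u l j ≤ δ
    -- * K * W.u l' (j + 1)`, so its norm is at most `δ * M`.
    obtain ⟨δ, hδ, hδM⟩ := ENNReal.exists_nnreal_pos_mul_lt hMtop (tsub_pos_of_lt hlt).ne'
    obtain ⟨u', h1, h2, h3, h4, h5, h6⟩ := exists_equivalent_weight (W := W) l hδ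
    refine ⟨u', h1, h2, h3, h4, h6, ?_⟩
    have hA : wnorm (wt u' ρ) a ≤ wnorm (wt 1 ρ) a := by
      refine (wnorm_le_mul_wnorm (C := 1) (v' := wt 1 ρ) fun d hd => ?_).trans (by simp)
      simp [wt, ha0 d hd, h3]
    have hB : wnorm (wt u' ρ) (g - constPart g) ≤ δ * M := by
      rw [hM, ← mul_assoc, ← ENNReal.coe_mul]
      refine wnorm_le_of_coeff_le id Function.injective_id fun d hd => ?_
      have hd0 : d 0 ≠ 0 := fun h0 => hd (by simp [coeff_constPart, h0])
      obtain ⟨j, hj⟩ := Nat.exists_eq_succ_of_ne_zero hd0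
      have hw : wt u' ρ d ≤ δ * K * wt (W.u l') ρ d := by
        unfold wt
        rw [← mul_assoc, hj]
        gcongr
        calc u' (j + 1) ≤ δ * W.u l j := h5 j
          _ ≤ δ * (K * W.u l' (j + 1)) := by gcongr; exact hK j
          _ = _ := by ring
      calc _ = ‖MvPowerSeries.coeff d g‖ₑ * wt u' ρ d := by simp [coeff_constPart, hd0]
        _ ≤ ‖MvPowerSeries.coeff d g‖ₑ * (δ * K * wt (W.u l') ρ d : ℝ≥0) := by gcongr
        _ = _ := by push_cast; simp only [id]; ring
    have hwe : wt u' ρ e = wt 1 ρ e := by simp [wt, he, h3]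
    calc wnorm (wt u' ρ) (g - MvPowerSeries.monomial e 1)
        = wnorm (wt u' ρ) (a + (g - constPart g)) := by rw [ha]; congr 1; ring
      _ ≤ wnorm (wt 1 ρ) a + δ * M := (wnorm_add_le _ _ _).trans (add_le_add hA hB)
      _ < wt u' ρ e := by
          rw [hwe]
          calc _ < wnorm (wt 1 ρ) a + (wt 1 ρ e - wnorm (wt 1 ρ) a) := by
                exact ENNReal.add_lt_add_left hlt.ne_top hδM
            _ = _ := add_tsub_cancel_of_le hlt.le
  choose u' h1 h2 h3 h4 h5 h6 using key
  have : Nonempty {l : Set.Ioo (0 : ℝ) S // (l : ℝ) < h} := by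
    obtain ⟨m, hm, hm'⟩ := exists_between hh0
    exact ⟨⟨⟨m, hm, hm'.trans_le hh⟩, hm'⟩⟩
  obtain ⟨q, hq, hq'⟩ := exists_division e f g (fun l => wt (u' l) ρ)
    (fun l => wt_pos (h1 l) hρ) (fun l => wt_add_le (h2 l))
    (fun l d => wt_add_of_zero d e he (h3 l)) h6
    (fun l => (wnorm_mono (wt_mono_left (h4 l)) f).trans_lt (hf l.1 l.2))
  refine ⟨q, ⟨ρ, hρ, fun l hl => ?_⟩, hq⟩
  obtain ⟨C, hC⟩ := h5 ⟨l, hl⟩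
  refine (wnorm_le_mul_wnorm (C := C) fun d _ => ?_).trans_lt
    (ENNReal.mul_lt_top ENNReal.coe_lt_top (hq' ⟨l, hl⟩))
  unfold wt
  rw [← mul_assoc]
  gcongr
  exact hC _

/-- Division by a series whose part without `t` has, for some positive grading of the variables `z`,
a unique term of lowest degree. -/
lemma exists_division_of_lowest (hh0 : 0 < h) (hh : h ≤ S) {e : Fin (n + 1) →₀ ℕ} (he : e 0 = 0)
    {f g : MvPowerSeries (Fin (n + 1)) ℂ} (hf : f ∈ W.conv n h) (hg : g ∈ W.conv n h)
    (hge : MvPowerSeries.coeff e g ≠ 0) (k : Fin n → ℕ)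
    (hk : ∀ d : Fin (n + 1) →₀ ℕ, d 0 = 0 → d ≠ e → MvPowerSeries.coeff d g ≠ 0 →
      ∑ i, k i * e i.succ < ∑ i, k i * d i.succ) :
    ∃ q ∈ W.conv n h, ∀ d, MvPowerSeries.coeff (d + e) (f - q * g) = 0 := by
  classical
  set c := MvPowerSeries.coeff e g with hc
  -- Normalizes the coefficient at `e` to 1, so that the divisor has the form X^e + r.
  set g' := MvPowerSeries.C c⁻¹ * g with hg'
  have hg'c : g' ∈ W.conv n h := mul_mem (C_mem_conv _) hg
  suffices H : ∃ q ∈ W.conv n h, ∀ d, MvPowerSeries.coeff (d + e) (f - q * g') = 0 by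
    obtain ⟨q, hq, H⟩ := H
    refine ⟨q * MvPowerSeries.C c⁻¹, mul_mem hq (C_mem_conv _), fun d => ?_⟩
    rw [mul_assoc]
    exact H d
  have hcoeff : ∀ d, MvPowerSeries.coeff d g' = c⁻¹ * MvPowerSeries.coeff d g := fun d => by
    simp [hg']
  obtain ⟨ρ, hρ, hfρ⟩ := hf
  obtain ⟨ρ', hρ', hgρ⟩ := hg'c
  set r : Fin n → ℝ≥0 := ρ ⊓ ρ' with hr
  have hr0 : ∀ i, 0 < r i := fun i => lt_min (hρ i) (hρ' i)
  set a := constPart g' - MvPowerSeries.monomial e 1 with ha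
  have ha0 : ∀ d : Fin (n + 1) →₀ ℕ, MvPowerSeries.coeff d a ≠ 0 → d 0 = 0 ∧
      ∑ i, k i * e i.succ < ∑ i, k i * d i.succ := by
    intro d hd
    by_cases hde : d = e
    · subst hde
      simp [ha, coeff_constPart, he, hcoeff, ← hc, hge] at hd
    · simp only [ha, map_sub, coeff_constPart, MvPowerSeries.coeff_monomial, hde, if_false,
        sub_zero, hcoeff, ne_eq, ite_eq_right_iff, Classical.not_imp, mul_eq_zero, not_or] at hd
      exact ⟨hd.1, hk d hd.1 hde hd.2.2⟩
  obtain ⟨m, hm, hm'⟩ := exists_between hh0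
  let l₀ : Set.Ioo (0 : ℝ) S := ⟨m, hm, hm'.trans_le hh⟩
  have hgr : wnorm (wt (W.u l₀) r) g' < ⊤ :=
    (wnorm_mono (wt_mono_right inf_le_right) g').trans_lt (hgρ l₀ hm')
  -- `a` has only t-free terms, on which all weights `W.u l` equal 1; any one level gives
  -- finiteness.
  have hatop : wnorm (wt 1 r) a ≠ ⊤ := by
    refine ne_of_lt (lt_of_le_of_lt (wnorm_sub_le _ _ _) (ENNReal.add_lt_top.2 ⟨?_, ?_⟩))
    · refine lt_of_le_of_lt (wnorm_le_of_coeff_le (C := 1) (v' := wt (W.u l₀) r) id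
        Function.injective_id (g := g') fun d hd => ?_) (by simpa using hgr)
      rw [coeff_constPart] at hd ⊢
      split_ifs at hd ⊢ with h0
      · simp [wt, h0]
      · exact absurd rfl hd
    · rw [wnorm_monomial]; exact ENNReal.mul_lt_top (by simp) ENNReal.coe_lt_top
  have hwe0 : (wt 1 r e : ℝ≥0∞) ≠ 0 := by
    simpa using (wt_pos (u := 1) (fun _ => one_pos) hr0 e).ne'
  -- Scaling the radius of z_i by `ε ^ k i` multiplies the norm of X^e by `ε ^ κ`, with κ its degree
  -- in the grading, and that of each term of `a` by at most `ε ^ (κ + 1)`. The additional factor ε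
  -- yields the required strict inequality.
  obtain ⟨ε₀, hε₀, hε₀lt⟩ := ENNReal.exists_nnreal_pos_mul_lt hatop hwe0
  set ε := min ε₀ 1 with hε
  have hε0 : 0 < ε := lt_min hε₀ one_pos
  have hε1 : ε ≤ 1 := min_le_right _ _
  have hεlt : ε * wnorm (wt 1 r) a < wt 1 r e :=
    lt_of_le_of_lt (by gcongr; exact min_le_left _ _) hε₀lt
  have hwt : ∀ d : Fin (n + 1) →₀ ℕ, wt 1 (fun i => ε ^ k i * r i) d =
      ε ^ (∑ i, k i * d i.succ) * wt 1 r d := fun d => by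
    simp [wt, mul_pow, Finset.prod_mul_distrib, ← pow_mul, Finset.prod_pow_eq_pow_sum]
  have hle : (fun i => ε ^ k i * r i) ≤ r := fun i =>
    mul_le_of_le_one_left' (pow_le_one₀ zero_le hε1)
  refine exists_division_of_wnorm_lt hh0 hh he (ρ := fun i => ε ^ k i * r i)
    (fun i => mul_pos (pow_pos hε0 _) (hr0 i))
    (fun l hl => (wnorm_mono (wt_mono_right (hle.trans inf_le_left)) f).trans_lt (hfρ l hl))
    (fun l hl => (wnorm_mono (wt_mono_right (hle.trans inf_le_right)) g').trans_lt (hgρ l hl)) ?_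
  set κ := ∑ i, k i * e i.succ with hκ
  calc wnorm (wt 1 (fun i => ε ^ k i * r i)) a ≤ (ε ^ (κ + 1) : ℝ≥0) * wnorm (wt 1 r) a := by
        refine wnorm_le_mul_wnorm fun d hd => ?_
        rw [hwt]
        gcongr ?_ * _
        exact pow_le_pow_of_le_one zero_le hε1 (ha0 d hd).2
    _ = (ε ^ κ : ℝ≥0) * (ε * wnorm (wt 1 r) a) := by push_cast; ring
    _ < (ε ^ κ : ℝ≥0) * wt 1 r e := by
        refine ENNReal.mul_lt_mul_right (by simpa using (pow_pos hε0 κ).ne') ENNReal.coe_ne_top hεlt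
    _ = _ := by rw [hwt]; push_cast; rfl

/-- Division of 1 by g with `e = 0` leaves no remainder at all. -/
lemma isUnit_conv (hh0 : 0 < h) (hh : h ≤ S) {g : W.conv n h}
    (hg : MvPowerSeries.coeff 0 g.1 ≠ 0) : IsUnit g := by
  obtain ⟨q, hq, H⟩ := exists_division_of_lowest hh0 hh (e := 0) rfl (one_mem (W.conv n h)) g.2 hg
    (fun _ => 1) (by
      intro d hd hd0 _
      simp only [Finsupp.coe_zero, Pi.zero_apply, mul_zero, Finset.sum_const_zero, one_mul]
      refine Nat.pos_of_ne_zero fun hs => hd0 ?_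
      ext i
      cases i using Fin.cases with
      | zero => exact hd
      | succ i => exact (Finset.sum_eq_zero_iff.1 hs) i (Finset.mem_univ i))
  refine IsUnit.of_mul_eq_one ⟨q, hq⟩ (Subtype.ext ?_)
  have : 1 - q * g.1 = 0 := MvPowerSeries.ext fun d => by simpa using H d
  rw [sub_eq_zero] at this
  simpa [mul_comm] using this.symm

/-- Weierstrass division by a series that is regular in the last variable. -/
lemma weierstrass_division (hh0 : 0 < h) (hh : h ≤ S)
    {f g : MvPowerSeries (Fin (n + 1 + 1)) ℂ} (hf : f ∈ W.conv (n + 1) h)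
    (hg : g ∈ W.conv (n + 1) h) {m : ℕ}
    (hgm : MvPowerSeries.coeff (Finsupp.single (Fin.last _) m) g ≠ 0)
    (hlt : ∀ i < m, MvPowerSeries.coeff (Finsupp.single (Fin.last _) i) g = 0) :
    ∃ q ∈ W.conv (n + 1) h, ∀ d : Fin (n + 1 + 1) →₀ ℕ, m ≤ d (Fin.last _) →
      MvPowerSeries.coeff d (f - q * g) = 0 := by
  classical
  set e : Fin (n + 1 + 1) →₀ ℕ := Finsupp.single (Fin.last _) m with he
  have hlast : (Fin.last (n + 1)) = (Fin.last n).succ := rfl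
  have hκ : ∀ d : Fin (n + 1 + 1) →₀ ℕ,
      ∑ i : Fin (n + 1), (if i = Fin.last n then 1 else m + 1) * d i.succ =
        (m + 1) * ∑ i : Fin n, d i.castSucc.succ + d (Fin.last _) := fun d => by
    rw [Fin.sum_univ_castSucc, Finset.mul_sum]
    simp [(Fin.castSucc_lt_last _).ne]
  -- With weight 1 for the last variable and m + 1 for the others, its m-th power is the unique
  -- t-free term of lowest degree: a monomial in which another z-variable occurs has degree at least
  -- m + 1, and the lower pure powers are absent by `hlt`.
  obtain ⟨q, hq, H⟩ := exists_division_of_lowest hh0 hh (e := e)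
    (by simp [he]) hf hg hgm (fun i => if i = Fin.last n then 1 else m + 1) (by
      intro d hd hde hdg
      rw [hκ, hκ]
      have h1 : ∑ i : Fin n, e i.castSucc.succ = 0 := Finset.sum_eq_zero fun i _ => by
        rw [he, Finsupp.single_apply, if_neg]
        rw [hlast, Fin.succ_inj]
        exact (Fin.castSucc_lt_last i).ne'
      have h2 : e (Fin.last _) = m := by simp [he]
      rw [h1, h2]
      rcases Nat.eq_zero_or_pos (∑ i : Fin n, d i.castSucc.succ) with h0 | h0
      · have hds : d = Finsupp.single (Fin.last _) (d (Fin.last _)) := by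
          ext i
          cases i using Fin.cases with
          | zero => simp [hd]
          | succ i =>
            cases i using Fin.lastCases with
            | last => simp
            | cast i =>
              rw [Finset.sum_eq_zero_iff.1 h0 i (Finset.mem_univ i), Finsupp.single_apply, if_neg]
              rw [hlast, Fin.succ_inj]
              exact (Fin.castSucc_lt_last i).ne'
        rcases lt_trichotomy (d (Fin.last _)) m with hm | hm | hm
        · exact absurd (hds ▸ hlt _ hm) hdg
        · exact absurd (by rw [hds, hm]) hde
        · simpa [h0] using hm
      · nlinarith)
  refine ⟨q, hq, fun d hd => ?_⟩
  have : d - e + e = d := tsub_add_cancel_of_le (by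
    rw [he, Finsupp.single_le_iff]
    exact hd)
  rw [← this]
  exact H _

end WeightFamily

/-! ### A criterion for flatness -/

section Flatness

variable {A B : Type*} [CommRing A] [CommRing B] [Algebra A B]

/-- Successive approximation: an element of m^N B is a combination of elements of m^N with
coefficients in B, and replacing these coefficients by elements of A that agree with them modulo m B
changes it only by an element of m^(N+1) B. -/
lemma exists_sub_mem_map_pow (m : Ideal A)
    (hsurj : ∀ b : B, ∃ a : A, b - algebraMap A B a ∈ m.map (algebraMap A B)) (N : ℕ) (b : B) :
    ∃ a : A, b - algebraMap A B a ∈ (m ^ N).map (algebraMap A B) := by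
  induction N with
  | zero => exact ⟨0, by simp [Ideal.map_top]⟩
  | succ N ih =>
    have key : ∀ c ∈ (m ^ N).map (algebraMap A B),
        ∃ a ∈ m ^ N, c - algebraMap A B a ∈ (m ^ (N + 1)).map (algebraMap A B) := by
      intro c hc
      refine Submodule.span_induction ?_ ⟨0, by simp⟩ ?_ ?_ hc
      · rintro _ ⟨a, ha, rfl⟩
        exact ⟨a, ha, by simp⟩
      · rintro x y - - ⟨a, hm, ha⟩ ⟨a', hm', ha'⟩
        refine ⟨a + a', add_mem hm hm', ?_⟩
        rw [map_add, add_sub_add_comm]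
        exact add_mem ha ha'
      · rintro b x - ⟨a, hm, ha⟩
        obtain ⟨a', ha'⟩ := hsurj b
        refine ⟨a' * a, Ideal.mul_mem_left _ _ hm, ?_⟩
        have : b • x - algebraMap A B (a' * a) = b * (x - algebraMap A B a) +
            algebraMap A B a * (b - algebraMap A B a') := by
          rw [map_mul, smul_eq_mul]; ring
        rw [this]
        refine add_mem (Ideal.mul_mem_left _ _ ha) ?_
        rw [pow_succ, Ideal.map_mul]
        exact Ideal.mul_mem_mul (Ideal.mem_map_of_mem _ hm) ha'
    obtain ⟨a, ha⟩ := ih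
    obtain ⟨a', -, ha'⟩ := key _ ha
    exact ⟨a + a', by rwa [map_add, ← sub_sub]⟩

lemma mem_smul_top_pi {ι : Type*} [Fintype ι] {J : Ideal B} {x : ι → B} (hx : ∀ i, x i ∈ J) :
    x ∈ J • (⊤ : Submodule B (ι → B)) := by
  classical
  rw [← Finset.univ_sum_single x]
  refine sum_mem fun i _ => ?_
  have : Pi.single i (x i) = x i • (Pi.single i 1 : ι → B) := by
    rw [← Pi.single_smul]; simp
  rw [this]
  exact Submodule.smul_mem_smul (hx i) trivial

/-- A homomorphism of Noetherian rings into a local ring that induces isomorphisms modulo all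
powers of an ideal `m` with `m B ≠ B` is flat. -/
theorem flat_of_forall_comap_map_pow_le [IsNoetherianRing A] [IsNoetherianRing B] [IsLocalRing B]
    (m : Ideal A) (hm : m.map (algebraMap A B) ≠ ⊤)
    (hinj : ∀ N, ((m ^ N).map (algebraMap A B)).comap (algebraMap A B) ≤ m ^ N)
    (hsurj : ∀ b : B, ∃ a : A, b - algebraMap A B a ∈ m.map (algebraMap A B)) :
    Module.Flat A B := by
  rw [Module.Flat.iff_forall_isTrivialRelation]
  intro l f x hfx
  -- By the equational criterion, every relation over B must be a B-combination of relations over A,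
  -- that is, lie in `L`. It is shown to lie in L + (m B)^N B^l for every N, and Krull's theorem for
  -- the finite module B^l / L concludes.
  let rel : Set (Fin l → A) := {a | ∑ i, f i * a i = 0}
  let φ : (Fin l → A) → (Fin l → B) := fun a i => algebraMap A B (a i)
  let L : Submodule B (Fin l → B) := Submodule.span B (φ '' rel)
  suffices hxL : x ∈ L by
    obtain ⟨k, c, g, hcg⟩ := Submodule.mem_span_set'.1 hxL
    choose a ha hga using fun j => (g j).2
    refine ⟨k, fun i j => a j i, c, fun i => ?_, fun j => ha j⟩
    rw [← hcg, Finset.sum_apply]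
    refine Finset.sum_congr rfl fun j _ => ?_
    rw [Pi.smul_apply, ← hga j, smul_eq_mul, mul_comm, Algebra.smul_def]
  have hN : ∀ N, x ∈ L ⊔ (m.map (algebraMap A B)) ^ N • (⊤ : Submodule B (Fin l → B)) := by
    intro N
    -- `c` is the Artin–Rees constant of the ideal (f). If a approximates x modulo m^(N+c) B, then ∑
    -- f_i a_i lies in m^(N+c) by `hinj`, hence in m^N (f). Writing it as ∑ f_i c'_i with c'_i in
    -- m^N turns a - c' into an exact relation over A that still approximates x modulo m^N B.
    obtain ⟨c, hc⟩ := m.exists_pow_inf_eq_pow_smul (M := A) (Submodule.span A (Set.range f))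
    choose a ha using fun i => exists_sub_mem_map_pow m hsurj (N + c) (x i)
    have hs : ∑ i, f i * a i ∈ m ^ (N + c) := by
      refine hinj _ ?_
      rw [Ideal.mem_comap, map_sum]
      have : ∑ i, algebraMap A B (f i * a i) =
          -∑ i, algebraMap A B (f i) * (x i - algebraMap A B (a i)) := by
        simp only [mul_sub, Finset.sum_sub_distrib, ← Algebra.smul_def, hfx]
        simp [Algebra.smul_def]
      rw [this]
      exact neg_mem (sum_mem fun i _ => Ideal.mul_mem_left _ _ (ha i))
    have hs' : ∑ i, f i * a i ∈ m ^ N • Submodule.span A (Set.range f) := by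
      have h1 : ∑ i, f i * a i ∈ m ^ (N + c) • (⊤ : Submodule A A) ⊓
          Submodule.span A (Set.range f) := by
        refine ⟨by simpa using hs, sum_mem fun i _ => ?_⟩
        rw [mul_comm]
        exact Submodule.smul_mem _ _ (Submodule.subset_span ⟨i, rfl⟩)
      rw [hc _ (Nat.le_add_left c N), Nat.add_sub_cancel] at h1
      exact Submodule.smul_mono le_rfl inf_le_right h1
    obtain ⟨c', hc', hcs⟩ := (Submodule.mem_ideal_smul_span_iff_exists_sum _ _ _).1 hs'
    rw [Finsupp.sum_fintype _ _ (by simp)] at hcs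
    have h1 : φ (fun i => a i - c' i) ∈ L := by
      refine Submodule.subset_span ⟨_, ?_, rfl⟩
      change ∑ i, f i * (a i - c' i) = 0
      simp only [mul_sub, Finset.sum_sub_distrib, ← hcs, smul_eq_mul]
      simp [mul_comm]
    have h2 : x - φ (fun i => a i - c' i) ∈
        (m.map (algebraMap A B)) ^ N • (⊤ : Submodule B (Fin l → B)) := by
      refine mem_smul_top_pi fun i => ?_
      have h3 : x i - algebraMap A B (a i) ∈ (m.map (algebraMap A B)) ^ N := by
        rw [← Ideal.map_pow]
        exact Ideal.map_mono (Ideal.pow_le_pow_right (Nat.le_add_right N c)) (ha i)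
      have h4 : algebraMap A B (c' i) ∈ (m.map (algebraMap A B)) ^ N := by
        rw [← Ideal.map_pow]
        exact Ideal.mem_map_of_mem _ (hc' i)
      simpa [φ, sub_add] using add_mem h3 h4
    simpa using Submodule.add_mem_sup h1 h2
  have hK := Ideal.iInf_pow_smul_eq_bot_of_isLocalRing (M := (Fin l → B) ⧸ L) _ hm
  rw [← Submodule.Quotient.mk_eq_zero, ← Submodule.mem_bot B, ← hK, Submodule.mem_iInf]
  intro N
  obtain ⟨y, hy, z, hz, hyz⟩ := Submodule.mem_sup.1 (hN N)
  rw [← hyz, Submodule.Quotient.mk_add, (Submodule.Quotient.mk_eq_zero L).2 hy, zero_add]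
  have := Submodule.mem_map_of_mem (f := L.mkQ) hz
  rw [Submodule.map_smul''] at this
  exact Submodule.smul_mono le_rfl le_top this

end Flatness

/-! ### The maximal ideal of convergent series, and flatness -/

namespace WeightFamily

variable {S : ℝ} {W : WeightFamily S} {n : ℕ} {h : ℝ}

/-- The ideal of `conv` generated by all the variables. -/
noncomputable def varIdeal (W : WeightFamily S) (n : ℕ) (h : ℝ) : Ideal (W.conv n h) :=
  Ideal.span (Set.range fun i => ⟨MvPowerSeries.X i, X_mem_conv i⟩)

/-- The ideal of the series of order at least `N`. -/
noncomputable def orderIdeal (W : WeightFamily S) (n : ℕ) (h : ℝ) (N : ℕ) :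
    Ideal (W.conv n h) where
  carrier := {f | (N : ℕ∞) ≤ f.1.order}
  add_mem' := fun {_ _} hf hg => (le_min hf hg).trans MvPowerSeries.min_order_le_add
  zero_mem' := by simp
  smul_mem' := fun c f hf =>
    (le_add_left (a := (N : ℕ∞)) hf).trans (MvPowerSeries.le_order_mul (f := c.1) (g := f.1))

lemma varIdeal_pow_le_orderIdeal (N : ℕ) : W.varIdeal n h ^ N ≤ W.orderIdeal n h N := by
  induction N with
  | zero => intro f _; exact bot_le (α := ℕ∞)
  | succ N ih =>
    rw [pow_succ, Ideal.mul_le]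
    intro f hf g hg
    have h1 : (1 : ℕ∞) ≤ g.1.order := by
      have : W.varIdeal n h ≤ W.orderIdeal n h 1 := by
        refine Ideal.span_le.2 ?_
        rintro _ ⟨i, rfl⟩
        change ((1 : ℕ) : ℕ∞) ≤ (MvPowerSeries.X i : MvPowerSeries _ ℂ).order
        rw [Nat.cast_one, MvPowerSeries.one_le_order_iff_constCoeff_eq_zero]
        simp
      exact_mod_cast this hg
    have h2 := add_le_add (ih hf) h1
    have h3 : ((N + 1 : ℕ) : ℕ∞) ≤ (f.1 * g.1).order := by
      push_cast
      exact h2.trans MvPowerSeries.le_order_mul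
    exact h3

/-- A series without constant term is a combination of the variables. -/
lemma exists_eq_sum_X_mul (hh : h ≤ S) (f : W.conv n h) {N : ℕ} (hf : f ∈ W.orderIdeal n h (N + 1)) :
    ∃ g : Fin (n + 1) → W.conv n h, (∀ i, g i ∈ W.orderIdeal n h N) ∧
      f = ∑ i, g i * ⟨MvPowerSeries.X i, X_mem_conv i⟩ := by
  classical
  -- `P d i` says that `i` is the first variable occurring in the monomial `d`. Each monomial is
  -- assigned to its first variable, so every nonconstant term is divided exactly once.
  let P : (Fin (n + 1) →₀ ℕ) → Fin (n + 1) → Prop := fun d i => d i ≠ 0 ∧ ∀ j < i, d j = 0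
  let g : Fin (n + 1) → MvPowerSeries (Fin (n + 1)) ℂ := fun i d =>
    if P (d + Finsupp.single i 1) i then MvPowerSeries.coeff (d + Finsupp.single i 1) f.1 else 0
  have hg : ∀ i d, MvPowerSeries.coeff d (g i) = if P (d + Finsupp.single i 1) i then
      MvPowerSeries.coeff (d + Finsupp.single i 1) f.1 else 0 := fun _ _ => rfl
  have hgc : ∀ i, g i ∈ W.conv n h := fun i => shift_mem_conv hh f.2 i fun d hd => by
    rw [hg] at hd ⊢
    split_ifs at hd ⊢
    · rfl
    · exact absurd rfl hd
  refine ⟨fun i => ⟨g i, hgc i⟩, fun i => ?_, Subtype.ext ?_⟩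
  · refine MvPowerSeries.nat_le_order fun d hd => ?_
    rw [hg]
    split_ifs
    · refine MvPowerSeries.coeff_of_lt_order (lt_of_lt_of_le ?_ hf)
      rw [map_add, Finsupp.degree_single]
      exact_mod_cast Nat.add_lt_add_right hd 1
    · rfl
  · ext d
    have h1 : ∀ i, MvPowerSeries.coeff d (g i * MvPowerSeries.X i) =
        if P d i then MvPowerSeries.coeff d f.1 else 0 := fun i => by
      by_cases hd : d i = 0
      · rw [if_neg fun hP => hP.1 hd, MvPowerSeries.X, mul_comm,
          MvPowerSeries.coeff_monomial_mul, if_neg]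
        intro hle
        have := hle i
        simp [hd] at this
      · have hd' : d - Finsupp.single i 1 + Finsupp.single i 1 = d := by
          refine tsub_add_cancel_of_le ?_
          rw [Finsupp.single_le_iff]
          exact Nat.one_le_iff_ne_zero.2 hd
        rw [← hd', MvPowerSeries.X, MvPowerSeries.coeff_add_mul_monomial, hg, mul_one]
    have h2 : ((∑ i, (⟨g i, hgc i⟩ : W.conv n h) * ⟨MvPowerSeries.X i, X_mem_conv i⟩ :
        W.conv n h) : MvPowerSeries (Fin (n + 1)) ℂ) = ∑ i, g i * MvPowerSeries.X i := by
      simp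
    rw [h2, map_sum]
    simp_rw [h1]
    by_cases hd : d = 0
    · have : MvPowerSeries.coeff d f.1 = 0 :=
        MvPowerSeries.coeff_of_lt_order (lt_of_lt_of_le (by rw [hd]; simp) hf)
      simp [this]
    · have hex : ∃ i, d i ≠ 0 := by
        by_contra! h0
        exact hd (Finsupp.ext h0)
      have hPu : ∀ i, P d i ↔ i = Fin.find (fun i => d i ≠ 0) hex := fun i => by
        rw [eq_comm, Fin.find_eq_iff]
        simp [P]
      simp_rw [hPu]
      simp

/-- Together with `varIdeal_pow_le_orderIdeal` this describes the powers of the maximal ideal by the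
order, which is the same in `W.conv n h` and in `W.conv n k`. -/
lemma orderIdeal_le_varIdeal_pow (hh : h ≤ S) (N : ℕ) :
    W.orderIdeal n h N ≤ W.varIdeal n h ^ N := by
  induction N with
  | zero => simp
  | succ N ih =>
    intro f hf
    obtain ⟨g, hg, rfl⟩ := exists_eq_sum_X_mul hh f hf
    rw [pow_succ]
    exact sum_mem fun i _ => Ideal.mul_mem_mul (ih (hg i)) (Ideal.subset_span ⟨i, rfl⟩)

lemma mem_varIdeal_iff (hh : h ≤ S) {f : W.conv n h} :
    f ∈ W.varIdeal n h ↔ MvPowerSeries.coeff 0 f.1 = 0 := by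
  have : f ∈ W.varIdeal n h ↔ f ∈ W.orderIdeal n h 1 := by
    rw [← pow_one (W.varIdeal n h)]
    exact ⟨fun hf => varIdeal_pow_le_orderIdeal 1 hf, fun hf => orderIdeal_le_varIdeal_pow hh 1 hf⟩
  rw [this]
  change ((1 : ℕ) : ℕ∞) ≤ f.1.order ↔ _
  rw [Nat.cast_one, MvPowerSeries.one_le_order_iff_constCoeff_eq_zero]
  rfl

lemma isUnit_conv_iff (hh0 : 0 < h) (hh : h ≤ S) {f : W.conv n h} :
    IsUnit f ↔ MvPowerSeries.coeff 0 f.1 ≠ 0 := by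
  refine ⟨fun hf => ?_, isUnit_conv hh0 hh⟩
  have := (hf.map (W.conv n h).subtype).map (MvPowerSeries.constantCoeff (σ := Fin (n + 1)) (R := ℂ))
  exact this.ne_zero

lemma isLocalRing_conv (hh0 : 0 < h) (hh : h ≤ S) : IsLocalRing (W.conv n h) := by
  refine .of_isUnit_or_isUnit_one_sub_self fun f => ?_
  rw [isUnit_conv_iff hh0 hh, isUnit_conv_iff hh0 hh]
  by_contra! H
  have h1 : MvPowerSeries.coeff 0 (1 - f : W.conv n h).1 = 1 - MvPowerSeries.coeff 0 f.1 := by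
    simp
  rw [h1, H.1] at H
  simp at H

/-- The inclusion of convergent series for `k ≤ h`. -/
noncomputable def convIncl (W : WeightFamily S) (n : ℕ) {k h : ℝ} (hkh : k ≤ h) :
    W.conv n h →+* W.conv n k := Subring.inclusion (conv_anti hkh)

/-- Powers of the maximal ideal are detected by the order, units by the constant term, and constants
represent all residue classes. None of this depends on the level, so the criterion applies and the
inclusion is local. -/
lemma faithfullyFlat_convIncl {k : ℝ} (hk : 0 < k) (hkh : k ≤ h) (hh : h ≤ S)
    (hA : IsNoetherianRing (W.conv n h)) (hB : IsNoetherianRing (W.conv n k)) :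
    (W.convIncl n hkh).FaithfullyFlat := by
  have hkS : k ≤ S := hkh.trans hh
  have hh0 : 0 < h := hk.trans_le hkh
  let _ : Algebra (W.conv n h) (W.conv n k) := (W.convIncl n hkh).toAlgebra
  have _ := isLocalRing_conv (W := W) (n := n) hh0 hh
  have _ := isLocalRing_conv (W := W) (n := n) hk hkS
  have hmap : ∀ N, (W.varIdeal n h ^ N).map (algebraMap (W.conv n h) (W.conv n k)) =
      W.varIdeal n k ^ N := fun N => by
    rw [Ideal.map_pow, varIdeal, varIdeal, Ideal.map_span, ← Set.range_comp]
    rfl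
  have hmap1 := hmap 1
  rw [pow_one, pow_one] at hmap1
  have hflat : Module.Flat (W.conv n h) (W.conv n k) := by
    refine flat_of_forall_comap_map_pow_le (W.varIdeal n h) ?_ (fun N f hf => ?_) fun b => ?_
    · rw [hmap1, Ne, Ideal.eq_top_iff_one, mem_varIdeal_iff hkS]
      simp
    · rw [hmap] at hf
      exact orderIdeal_le_varIdeal_pow hh N (varIdeal_pow_le_orderIdeal (W := W) (h := k) N hf)
    · refine ⟨⟨MvPowerSeries.C (MvPowerSeries.coeff 0 b.1), C_mem_conv _⟩, ?_⟩
      rw [hmap1, mem_varIdeal_iff hkS]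
      change MvPowerSeries.coeff 0 (b.1 - MvPowerSeries.C (MvPowerSeries.coeff 0 b.1)) = 0
      simp
  have hloc : IsLocalHom (algebraMap (W.conv n h) (W.conv n k)) := ⟨fun f hf => by
    rw [isUnit_conv_iff hk hkS] at hf
    rw [isUnit_conv_iff hh0 hh]
    exact hf⟩
  exact Module.FaithfullyFlat.of_flat_of_isLocalHom

end WeightFamily

/-! ### Cauchy's formula and Taylor expansion on polydiscs -/

section Analysis

open MeasureTheory

lemma hasSum_of_eq {ι : Type*} {f g : ι → ℂ} {a : ℂ} (h : HasSum f a) (hfg : ∀ i, f i = g i) :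
    HasSum g a := funext hfg ▸ h

/-- Splitting off the first exponent. -/
noncomputable def consExpEquiv (n : ℕ) : ℕ × (Fin n →₀ ℕ) ≃ (Fin (n + 1) →₀ ℕ) where
  toFun p := Finsupp.cons p.1 p.2
  invFun d := (d 0, Finsupp.tail d)
  left_inv p := by simp
  right_inv d := by simp

@[simp] lemma consExpEquiv_apply {n : ℕ} (p : ℕ × (Fin n →₀ ℕ)) :
    consExpEquiv n p = Finsupp.cons p.1 p.2 := rfl

/-- Products of absolutely convergent series. -/
lemma hasSum_prod_exponents {n : ℕ} (f : Fin n → ℕ → ℂ) (s : Fin n → ℂ)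
    (hf : ∀ i, HasSum (f i) (s i)) (hf' : ∀ i, Summable fun j => ‖f i j‖) :
    HasSum (fun α : Fin n →₀ ℕ => ∏ i, f i (α i)) (∏ i, s i) ∧
      Summable fun α : Fin n →₀ ℕ => ‖∏ i, f i (α i)‖ := by
  induction n with
  | zero =>
    have h0 : ∀ α : Fin 0 →₀ ℕ, α = 0 := fun α => Finsupp.ext fun i => i.elim0
    have h1 := hasSum_single (f := fun _ : Fin 0 →₀ ℕ => (1 : ℂ)) 0 fun α hα => absurd (h0 α) hα
    simp only [Finset.univ_eq_empty, Finset.prod_empty]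
    exact ⟨h1, h1.summable.norm⟩
  | succ n ih =>
    obtain ⟨h1, h2⟩ := ih (fun i => f i.succ) (fun i => s i.succ) (fun i => hf _) (fun i => hf' _)
    have h3 := summable_mul_of_summable_norm (hf' 0) h2
    have hn : Summable fun p : ℕ × (Fin n →₀ ℕ) => ‖f 0 p.1 * ∏ i : Fin n, f i.succ (p.2 i)‖ :=
      h3.norm
    constructor
    · rw [← (consExpEquiv n).hasSum_iff, Fin.prod_univ_succ]
      simpa [Function.comp_def, Fin.prod_univ_succ] using (hf 0).mul h1 h3
    · rw [← (consExpEquiv n).summable_iff]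
      simpa [Function.comp_def, Fin.prod_univ_succ] using hn

lemma summable_prod_pow {n : ℕ} {x : Fin n → ℝ} (hx0 : ∀ i, 0 ≤ x i) (hx : ∀ i, x i < 1) :
    Summable fun α : Fin n →₀ ℕ => ∏ i, x i ^ α i := by
  have h := (hasSum_prod_exponents (fun i j => ((x i : ℂ)) ^ j) (fun i => (1 - (x i : ℂ))⁻¹)
    (fun i => hasSum_geometric_of_norm_lt_one (by simpa [abs_of_nonneg (hx0 i)] using hx i))
    (fun i => by
      simpa [abs_of_nonneg (hx0 i)] using summable_geometric_of_lt_one (hx0 i) (hx i))).2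
  refine h.congr fun α => ?_
  simp [abs_of_nonneg (hx0 _)]

/-- The point of the torus of radius `r` with arguments `θ`. -/
lemma norm_torusMap_zero {n : ℕ} {r : ℝ} (hr : 0 < r) (θ : Fin n → ℝ) (i : Fin n) :
    ‖torusMap 0 (fun _ => r) θ i‖ = r := by
  simp [torusMap, abs_of_pos hr, Complex.norm_exp_ofReal_mul_I]

lemma continuous_torusMap {n : ℕ} (c : Fin n → ℂ) (R : Fin n → ℝ) : Continuous (torusMap c R) := by
  unfold torusMap
  fun_prop

/-- The Cauchy integral formula on a polydisc. -/
lemma torusIntegral_cauchy {n : ℕ} {r : ℝ} (hr : 0 < r) {U : Set (Fin n → ℂ)} (hU : IsOpen U)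
    (hrU : ∀ z : Fin n → ℂ, (∀ i, ‖z i‖ ≤ r) → z ∈ U) {F : (Fin n → ℂ) → ℂ}
    (hF : DifferentiableOn ℂ F U) {z : Fin n → ℂ} (hz : ∀ i, ‖z i‖ < r) :
    torusIntegral (fun ζ => (∏ i, (ζ i - z i)⁻¹) * F ζ) 0 (fun _ => r) =
      (2 * Real.pi * Complex.I) ^ n * F z := by
  induction n with
  | zero =>
    rw [torusIntegral_dim0]
    simp [Subsingleton.elim z 0]
  | succ n ih =>
    have hne : ∀ (θ : Fin (n + 1) → ℝ) i, torusMap 0 (fun _ => r) θ i - z i ≠ 0 := fun θ i h0 => by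
      have := norm_torusMap_zero hr θ i
      rw [sub_eq_zero.1 h0] at this
      exact (hz i).ne this
    have hint : TorusIntegrable (fun ζ => (∏ i, (ζ i - z i)⁻¹) * F ζ) 0 (fun _ => r) := by
      refine Continuous.integrableOn_Icc (Continuous.mul ?_ ?_)
      · refine continuous_finsetProd _ fun i _ => Continuous.inv₀ ?_ fun θ => hne θ i
        have hc : Continuous fun θ => torusMap (0 : Fin (n + 1) → ℂ) (fun _ => r) θ i :=
          (continuous_pi_iff.1 (continuous_torusMap _ _)) i
        exact hc.sub continuous_const
      · exact hF.continuousOn.comp_continuous (continuous_torusMap _ _) fun θ =>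
          hrU _ fun i => (norm_torusMap_zero hr θ i).le
    rw [torusIntegral_succ hint]
    have hcons : ∀ w : Fin n → ℂ, Differentiable ℂ fun x : ℂ => (Fin.cons x w : Fin (n + 1) → ℂ) := by
      intro w
      refine differentiable_pi.2 fun i => ?_
      cases i using Fin.cases with
      | zero => simp
      | succ i => simp
    have hcons' : ∀ x : ℂ, Differentiable ℂ fun w : Fin n → ℂ =>
        (Fin.cons x w : Fin (n + 1) → ℂ) := by
      intro x
      refine differentiable_pi.2 fun i => ?_
      cases i using Fin.cases with
      | zero => simp
      | succ i => simpa using differentiable_apply i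
    have h1 : ∀ x ∈ Metric.sphere (0 : ℂ) r,
        torusIntegral (fun y => (∏ i, ((Fin.cons x y : Fin (n + 1) → ℂ) i - z i)⁻¹) *
          F (Fin.cons x y)) ((0 : Fin (n + 1) → ℂ) ∘ Fin.succ) ((fun _ => r) ∘ Fin.succ) =
        (x - z 0)⁻¹ * ((2 * Real.pi * Complex.I) ^ n * F (Fin.cons x (Fin.tail z))) := by
      intro x hx
      have := ih (U := {w | (Fin.cons x w : Fin (n + 1) → ℂ) ∈ U})
        (hU.preimage (hcons' x).continuous) (fun w hw => hrU _ fun i => by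
          cases i using Fin.cases with
          | zero => simpa using (mem_sphere_zero_iff_norm.1 hx).le
          | succ i => simpa using hw i)
        (F := fun w => F (Fin.cons x w))
        (hF.comp (hcons' x).differentiableOn fun w hw => hw) (z := Fin.tail z) (fun i => hz _)
      rw [← this, ← smul_eq_mul, ← torusIntegral_smul]
      congr 1
      ext y
      simp only [Fin.prod_univ_succ, Fin.tail, Fin.cons_zero, Fin.cons_succ]
      ring
    refine (circleIntegral.integral_congr hr.le h1).trans ?_
    have hz0 : z 0 ∈ Metric.ball (0 : ℂ) r := by simpa using hz 0
    have hdc : DifferentiableOn ℂ (fun x => F (Fin.cons x (Fin.tail z))) (Metric.closedBall 0 r) :=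
      hF.comp (hcons _).differentiableOn fun x hx => hrU _ fun i => by
        cases i using Fin.cases with
        | zero => simpa using hx
        | succ i => simpa [Fin.tail] using (hz i.succ).le
    have h2 := hdc.circleIntegral_sub_inv_smul hz0
    have h3 : ∀ x : ℂ, (x - z 0)⁻¹ * ((2 * Real.pi * Complex.I) ^ n * F (Fin.cons x (Fin.tail z))) =
        (2 * Real.pi * Complex.I) ^ n • ((x - z 0)⁻¹ • F (Fin.cons x (Fin.tail z))) := fun x => by
      simp only [smul_eq_mul]; ring
    simp_rw [h3]
    rw [circleIntegral.integral_smul, h2, Fin.cons_self_tail]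
    simp only [smul_eq_mul]
    ring

/-- Taylor expansion on a polydisc, with Cauchy's estimates. -/
theorem exists_taylor_polydisc {n : ℕ} {r : ℝ} (hr : 0 < r) {U : Set (Fin n → ℂ)} (hU : IsOpen U)
    (hrU : ∀ z : Fin n → ℂ, (∀ i, ‖z i‖ ≤ r) → z ∈ U) {F : (Fin n → ℂ) → ℂ}
    (hF : DifferentiableOn ℂ F U) :
    ∃ c : (Fin n →₀ ℕ) → ℂ,
      (∀ C : ℝ, (∀ z : Fin n → ℂ, (∀ i, ‖z i‖ ≤ r) → ‖F z‖ ≤ C) →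
        ∀ α : Fin n →₀ ℕ, ‖c α‖ * ∏ i, r ^ α i ≤ C) ∧
      ∀ z : Fin n → ℂ, (∀ i, ‖z i‖ < r) → HasSum (fun α : Fin n →₀ ℕ => c α * ∏ i, z i ^ α i) (F z) := by
  have h2pi : (2 * Real.pi * Complex.I : ℂ) ≠ 0 := Complex.two_pi_I_ne_zero
  set R : Fin n → ℝ := fun _ => r with hR
  have hne : ∀ (θ : Fin n → ℝ) i, torusMap 0 R θ i ≠ 0 := fun θ i h0 => by
    have := norm_torusMap_zero hr θ i
    rw [← hR, h0, norm_zero] at this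
    exact hr.ne this
  have hFc : Continuous fun θ => F (torusMap 0 R θ) :=
    hF.continuousOn.comp_continuous (continuous_torusMap _ _) fun θ =>
      hrU _ fun i => (norm_torusMap_zero hr θ i).le
  -- The Taylor coefficient at α is (2πi)^(-n) times the torus integral of `G α`. It is fixed before
  -- the bound `C`, because the same coefficients are later estimated at every level.
  let G : (Fin n →₀ ℕ) → (Fin n → ℂ) → ℂ := fun α ζ => (∏ i, (ζ i)⁻¹ ^ (α i + 1)) * F ζ
  have hGc : ∀ α, Continuous fun θ => G α (torusMap 0 R θ) := fun α => by
    refine Continuous.mul (continuous_finsetProd _ fun i _ => Continuous.pow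
      (Continuous.inv₀ ?_ fun θ => hne θ i) _) hFc
    exact (continuous_apply i).comp (continuous_torusMap _ _)
  have hnorm : ∀ (α : Fin n →₀ ℕ) θ, ‖∏ i, (torusMap 0 R θ i)⁻¹ ^ (α i + 1)‖ =
      (∏ i, r⁻¹ ^ α i) * (r⁻¹) ^ n := fun α θ => by
    rw [norm_prod]
    simp_rw [norm_pow, norm_inv, hR, norm_torusMap_zero hr]
    simp [pow_succ, Finset.prod_mul_distrib]
  refine ⟨fun α => ((2 * Real.pi * Complex.I) ^ n)⁻¹ * torusIntegral (G α) 0 R, ?_, ?_⟩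
  · intro C hC α
    have h1 : ‖torusIntegral (G α) 0 R‖ ≤ ((2 * Real.pi) ^ n * ∏ i : Fin n, |R i|) *
        (((∏ i, r⁻¹ ^ α i) * (r⁻¹) ^ n) * C) := by
      refine norm_torusIntegral_le_of_norm_le_const fun θ => ?_
      rw [norm_mul, hnorm]
      gcongr
      exact hC _ fun i => (norm_torusMap_zero hr θ i).le
    have h2 : ‖((2 * Real.pi * Complex.I : ℂ) ^ n)⁻¹‖ = ((2 * Real.pi) ^ n)⁻¹ := by
      simp [abs_of_pos Real.pi_pos]
    have h3 : ∏ i : Fin n, |R i| = r ^ n := by simp [hR, abs_of_pos hr]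
    have h4 : 0 < ∏ i : Fin n, r ^ α i := Finset.prod_pos fun i _ => pow_pos hr _
    have h5 : ∏ i : Fin n, r⁻¹ ^ α i = (∏ i : Fin n, r ^ α i)⁻¹ := by
      simp [inv_pow, Finset.prod_inv_distrib]
    rw [norm_mul, h2]
    rw [h3, h5] at h1
    have hpi := Real.pi_pos
    calc _ ≤ ((2 * Real.pi) ^ n)⁻¹ * (((2 * Real.pi) ^ n * r ^ n) *
          (((∏ i, r ^ α i)⁻¹ * (r⁻¹) ^ n) * C)) * ∏ i, r ^ α i := by gcongr
      _ = C := by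
        rw [inv_pow]
        field_simp
  · intro z hz
    have hC : ∃ C : ℝ, ∀ θ ∈ Set.Icc (0 : Fin n → ℝ) (fun _ => 2 * Real.pi),
        ‖F (torusMap 0 R θ)‖ ≤ C :=
      isCompact_Icc.exists_bound_of_continuousOn hFc.continuousOn
    obtain ⟨C, hC⟩ := hC
    have hx : ∀ i, ‖z i‖ * r⁻¹ < 1 := fun i => by
      rw [← div_eq_mul_inv, div_lt_one hr]; exact hz i
    have hx0 : ∀ i, 0 ≤ ‖z i‖ * r⁻¹ := fun i => by positivity
    -- The Cauchy kernel is expanded into geometric series in z_i / ζ_i and integrated termwise by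
    -- dominated convergence.
    have key : HasSum (fun α : Fin n →₀ ℕ => torusIntegral (fun ζ => (∏ i, z i ^ α i) * G α ζ) 0 R)
        (torusIntegral (fun ζ => (∏ i, (ζ i - z i)⁻¹) * F ζ) 0 R) := by
      refine hasSum_integral_of_dominated_convergence
        (fun α _ => r ^ n * ((∏ i, (‖z i‖ * r⁻¹) ^ α i) * (r⁻¹ ^ n * C))) (fun α => ?_) (fun α => ?_)
        ?_ ?_ ?_
      · have hprod : Continuous fun θ : Fin n → ℝ =>
            ∏ i, ((R i : ℂ) * Complex.exp (θ i * Complex.I) * Complex.I) := by fun_prop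
        refine Continuous.aestronglyMeasurable (hprod.smul ?_)
        exact continuous_const.mul (hGc α)
      · refine (ae_restrict_iff' measurableSet_Icc).2 (.of_forall fun θ hθ => ?_)
        simp only [G]
        rw [norm_smul, norm_mul, norm_mul, hnorm]
        have e1 : ‖∏ i : Fin n, (R i : ℂ) * Complex.exp (θ i * Complex.I) * Complex.I‖ = r ^ n := by
          simp [hR, abs_of_pos hr, Complex.norm_exp_ofReal_mul_I]
        rw [e1]
        have e2 : ∏ i, (‖z i‖ * r⁻¹) ^ α i = ‖∏ i, z i ^ α i‖ * ∏ i, r⁻¹ ^ α i := by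
          simp [mul_pow, Finset.prod_mul_distrib]
        rw [e2]
        simp only [mul_assoc]
        gcongr
        exact hC θ hθ
      · exact .of_forall fun _ => ((summable_prod_pow hx0 hx).mul_right _).mul_left _
      · exact integrableOn_const (measure_Icc_lt_top.ne)
      · refine .of_forall fun θ => ?_
        refine HasSum.const_smul _ ?_
        have hg : ∀ i, HasSum (fun j : ℕ => z i ^ j * (torusMap 0 R θ i)⁻¹ ^ (j + 1))
            (torusMap 0 R θ i - z i)⁻¹ := fun i => by
          have hlt : ‖z i * (torusMap 0 R θ i)⁻¹‖ < 1 := by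
            rw [norm_mul, norm_inv, hR, norm_torusMap_zero hr]; exact hx i
          have := (hasSum_geometric_of_norm_lt_one hlt).mul_left (torusMap 0 R θ i)⁻¹
          rw [← mul_inv, mul_sub, mul_one, mul_comm (z i), ← mul_assoc,
            mul_inv_cancel₀ (hne θ i), one_mul] at this
          refine hasSum_of_eq this fun j => ?_
          rw [mul_pow, pow_succ]
          ring
        have hg' : ∀ i, Summable fun j : ℕ => ‖z i ^ j * (torusMap 0 R θ i)⁻¹ ^ (j + 1)‖ := fun i => by
          have h1 := (summable_geometric_of_lt_one (hx0 i) (hx i)).mul_right r⁻¹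
          refine h1.congr fun j => ?_
          rw [norm_mul, norm_pow, norm_pow, norm_inv, hR, norm_torusMap_zero hr, mul_pow, pow_succ]
          ring
        have := (hasSum_prod_exponents _ _ hg hg').1.mul_right (F (torusMap 0 R θ))
        refine hasSum_of_eq this fun α => ?_
        simp only [G, Finset.prod_mul_distrib, mul_assoc]
    rw [torusIntegral_cauchy hr hU hrU hF hz] at key
    have := key.mul_left ((2 * Real.pi * Complex.I) ^ n)⁻¹
    rw [inv_mul_cancel_left₀ (pow_ne_zero _ h2pi)] at this
    refine hasSum_of_eq this fun α => ?_
    simp_rw [← smul_eq_mul (a := ∏ i, z i ^ α i), torusIntegral_smul, smul_eq_mul]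
    ring

end Analysis

/-! ### Uniqueness of power series, and normally convergent series -/

section PowerSeriesLemmas

/-- A power series in one variable that vanishes near the origin is zero. -/
lemma eq_zero_of_hasSum_pow {a : ℕ → ℂ} {r : ℝ} (hr : 0 < r)
    (h : ∀ z : ℂ, ‖z‖ < r → HasSum (fun j => a j * z ^ j) 0) (j : ℕ) : a j = 0 := by
  have hp : HasFPowerSeriesAt (0 : ℂ → ℂ) (FormalMultilinearSeries.ofScalars ℂ a) 0 := by
    rw [hasFPowerSeriesAt_iff]
    filter_upwards [Metric.ball_mem_nhds (0 : ℂ) hr] with z hz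
    refine hasSum_of_eq (h z (by simpa using hz)) fun j => ?_
    rw [FormalMultilinearSeries.coeff_ofScalars, smul_eq_mul, mul_comm]
  have := hp.eq_zero
  have h2 := congrArg (fun p => FormalMultilinearSeries.coeff p j) this
  rw [FormalMultilinearSeries.coeff_ofScalars] at h2
  exact h2

/-- A power series in several variables that vanishes near the origin is zero. -/
lemma eq_zero_of_hasSum_monomials {n : ℕ} {c : (Fin n →₀ ℕ) → ℂ} {r : ℝ} (hr : 0 < r)
    (h : ∀ z : Fin n → ℂ, (∀ i, ‖z i‖ < r) →
      (Summable fun α : Fin n →₀ ℕ => ‖c α * ∏ i, z i ^ α i‖) ∧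
      HasSum (fun α : Fin n →₀ ℕ => c α * ∏ i, z i ^ α i) 0) (α : Fin n →₀ ℕ) : c α = 0 := by
  induction n with
  | zero =>
    have h0 : ∀ β : Fin 0 →₀ ℕ, β = α := fun β => Finsupp.ext fun i => i.elim0
    have h1 := (h (fun i => i.elim0) fun i => i.elim0).2
    have h2 := hasSum_single (f := fun β : Fin 0 →₀ ℕ =>
      c β * ∏ i : Fin 0, (fun i : Fin 0 => (i.elim0 : ℂ)) i ^ β i) α fun β hβ => absurd (h0 β) hβ
    simpa using h2.unique h1
  | succ n ih =>
    have key : ∀ j, ∀ z' : Fin n → ℂ, (∀ i, ‖z' i‖ < r) →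
        (Summable fun β : Fin n →₀ ℕ => ‖c (Finsupp.cons j β) * ∏ i, z' i ^ β i‖) := by
      intro j z' hz'
      have h1 := (h (Fin.cons ((r / 2 : ℝ) : ℂ) z') (fun i => by
        cases i using Fin.cases with
        | zero => simpa [abs_of_pos hr] using half_lt_self hr
        | succ i => simpa using hz' i)).1
      rw [← (consExpEquiv n).summable_iff] at h1
      have h2 := h1.comp_injective (i := fun β : Fin n →₀ ℕ => (j, β)) fun _ _ hh => by simpa using hh
      have h3 := h2.mul_left (((r / 2) ^ j)⁻¹)
      refine h3.congr fun β => ?_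
      have hr2 : (r / 2) ≠ 0 := by positivity
      simp [Function.comp_def, Fin.prod_univ_succ, abs_of_pos hr]
      field_simp
    -- For fixed z' these sums are the coefficients of a power series in the first variable that
    -- vanishes near 0.
    have main : ∀ j, ∀ z' : Fin n → ℂ, (∀ i, ‖z' i‖ < r) →
        ∑' β : Fin n →₀ ℕ, c (Finsupp.cons j β) * ∏ i, z' i ^ β i = 0 := by
      intro j z' hz'
      refine eq_zero_of_hasSum_pow hr (a := fun j =>
        ∑' β : Fin n →₀ ℕ, c (Finsupp.cons j β) * ∏ i, z' i ^ β i) (fun z₀ hz₀ => ?_) j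
      have h1 := (h (Fin.cons z₀ z') (fun i => by
        cases i using Fin.cases with
        | zero => simpa using hz₀
        | succ i => simpa using hz' i)).2
      rw [← (consExpEquiv n).hasSum_iff] at h1
      refine h1.prod_fiberwise fun j => ?_
      have h2 := ((key j z' hz').of_norm.hasSum).mul_right (z₀ ^ j)
      refine hasSum_of_eq h2 fun β => ?_
      simp only [Function.comp_def, consExpEquiv_apply, Fin.prod_univ_succ, Fin.cons_zero,
        Fin.cons_succ, Finsupp.cons_zero, Finsupp.cons_succ]
      ring
    rw [← Finsupp.cons_tail α]
    refine ih (c := fun β => c (Finsupp.cons (α 0) β)) (fun z' hz' => ⟨key _ z' hz', ?_⟩) _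
    rw [← main (α 0) z' hz']
    exact (key _ z' hz').of_norm.hasSum

/-- Normally convergent series of holomorphic functions are holomorphic. -/
lemma differentiableOn_tsum_of_norm_le {ι E V : Type*} [NormedAddCommGroup E] [NormedSpace ℂ E]
    [NormedAddCommGroup V] [NormedSpace ℂ V] [CompleteSpace V] {F : ι → E → V} {r : ℝ}
    (hr : 0 < r) {b : ι → ℝ} (hb : Summable b)
    (hF : ∀ i, DifferentiableOn ℂ (F i) (Metric.ball 0 r))
    (hFb : ∀ i, ∀ z ∈ Metric.ball (0 : E) r, ‖F i z‖ ≤ b i) :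
    DifferentiableOn ℂ (fun z => ∑' i, F i z) (Metric.ball 0 (r / 2)) := by
  intro z hz
  have hsub : ∀ y ∈ Metric.ball (0 : E) (r / 2), Metric.ball y (r / 2) ⊆ Metric.ball 0 r := by
    intro y hy w hw
    rw [mem_ball_zero_iff] at hy ⊢
    rw [mem_ball_iff_norm] at hw
    calc ‖w‖ = ‖(w - y) + y‖ := by simp
      _ ≤ ‖w - y‖ + ‖y‖ := norm_add_le _ _
      _ < r := by linarith
  -- On a ball of radius r / 2 about y, values of `F i` differ from `F i y` by at most 2 b_i, so
  -- Cauchy's estimate bounds the derivative by 2 b_i / (r / 2).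
  refine (hasFDerivAt_tsum_of_isPreconnected (u := fun i => (2 * b i) / (r / 2))
    (f' := fun i y => fderiv ℂ (F i) y) (x₀ := 0) ((hb.mul_left 2).div_const _) Metric.isOpen_ball
    (convex_ball _ _).isPreconnected (fun i y hy => ?_) (fun i y hy => ?_)
    (Metric.mem_ball_self (by positivity)) ?_ hz).differentiableAt.differentiableWithinAt
  · refine ((hF i).differentiableAt (Metric.isOpen_ball.mem_nhds ?_)).hasFDerivAt
    exact Metric.ball_subset_ball (by linarith) hy
  · refine Complex.norm_fderiv_le_div_of_mapsTo_ball ((hF i).mono (hsub y hy)) (fun w hw => ?_)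
      (by positivity)
    rw [mem_closedBall_iff_norm]
    have h1 := hFb i w (hsub y hy hw)
    have h2 := hFb i y (hsub y hy (Metric.mem_ball_self (by positivity)))
    linarith [norm_sub_le (F i w) (F i y)]
  · exact Summable.of_norm_bounded hb fun i => hFb i 0 (Metric.mem_ball_self hr)

end PowerSeriesLemmas

/-! ### Coefficient functionals and completeness of A_l -/

namespace WeightFamily

variable {S : ℝ} (W : WeightFamily S)

/-- The coefficients are continuous on `A_l`. -/
lemma norm_coeff_le (l : Set.Ioo (0 : ℝ) S) (f : W.level l) (j : ℕ) :
    ‖PowerSeries.coeff j f.1‖ * W.w l j ≤ ‖f‖ :=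
  (f.2 : Summable (W.term l f.1)).le_tsum j fun i _ => W.term_nonneg l f.1 i

/-- The `j`-th coefficient as a continuous linear form on `A_l`. -/
noncomputable def coeffCLM (l : Set.Ioo (0 : ℝ) S) (j : ℕ) : W.level l →L[ℂ] ℂ :=
  LinearMap.mkContinuous ((PowerSeries.coeff (R := ℂ) j).comp (W.level l).val.toLinearMap)
    (W.w l j)⁻¹ fun f => by
      rw [inv_mul_eq_div, le_div_iff₀ (W.pos l j)]
      exact W.norm_coeff_le l f j

@[simp] lemma coeffCLM_apply (l : Set.Ioo (0 : ℝ) S) (j : ℕ) (f : W.level l) :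
    W.coeffCLM l j f = PowerSeries.coeff j f.1 := rfl

lemma level_ext {l : Set.Ioo (0 : ℝ) S} {f g : W.level l}
    (h : ∀ j, W.coeffCLM l j f = W.coeffCLM l j g) : f = g :=
  Subtype.ext (PowerSeries.ext h)

/-- An absolutely convergent series in A_l converges coefficientwise, and exchanging the two
summations bounds the norm of each tail by the tail of the norms. Completeness is needed for
normally convergent series with values in A_l. -/
instance completeSpace_level (l : Set.Ioo (0 : ℝ) S) : CompleteSpace (W.level l) := by
  refine NormedAddCommGroup.completeSpace_of_summable_imp_tendsto fun u hu => ?_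
  have hcs : ∀ j, Summable fun i => ‖PowerSeries.coeff j (u i).1‖ * W.w l j := fun j =>
    Summable.of_nonneg_of_le (fun i => W.term_nonneg l _ j) (fun i => W.norm_coeff_le l (u i) j) hu
  have hc : ∀ j, Summable fun i => ‖PowerSeries.coeff j (u i).1‖ := fun j => by
    refine ((hcs j).mul_right (W.w l j)⁻¹).congr fun i => ?_
    rw [mul_assoc, mul_inv_cancel₀ (W.pos l j).ne', mul_one]
  let a : ℂ⟦X⟧ := PowerSeries.mk fun j => ∑' i, PowerSeries.coeff j (u i).1
  have hterm : ∀ N j, ‖∑' i, PowerSeries.coeff j (u (i + N)).1‖ * W.w l j ≤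
      ∑' i, ‖PowerSeries.coeff j (u (i + N)).1‖ * W.w l j := fun N j => by
    rw [tsum_mul_right]
    gcongr
    · exact (W.pos l j).le
    · exact norm_tsum_le_tsum_norm ((summable_nat_add_iff N).2 (hc j))
  have hdouble : ∀ N, (Summable fun j => ∑' i, ‖PowerSeries.coeff j (u (i + N)).1‖ * W.w l j) ∧
      ∑' j, ∑' i, ‖PowerSeries.coeff j (u (i + N)).1‖ * W.w l j = ∑' i, ‖u (i + N)‖ := fun N => by
    have h1 : Summable fun p : ℕ × ℕ => ‖PowerSeries.coeff p.2 (u (p.1 + N)).1‖ * W.w l p.2 := by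
      refine (summable_prod_of_nonneg fun p => W.term_nonneg l (u (p.1 + N)).1 p.2).2 ⟨fun i => (u (i + N)).2, ?_⟩
      exact (summable_nat_add_iff N).2 hu
    have h2 := Summable.tsum_comm
      (f := fun i j => ‖PowerSeries.coeff j (u (i + N)).1‖ * W.w l j) h1
    exact ⟨h1.prod_symm.prod, h2⟩
  have hmem : ∀ N, (PowerSeries.mk fun j => ∑' i, PowerSeries.coeff j (u (i + N)).1) ∈
      W.level l := fun N => by
    refine Summable.of_nonneg_of_le (W.term_nonneg l _) (fun j => ?_) (hdouble N).1
    simpa [term] using hterm N j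
  refine ⟨⟨a, by simpa using hmem 0⟩, ?_⟩
  rw [tendsto_iff_norm_sub_tendsto_zero]
  refine squeeze_zero (fun _ => norm_nonneg _) (fun N => ?_) (tendsto_sum_nat_add fun i => ‖u i‖)
  have heq : ∑ i ∈ Finset.range N, u i - (⟨a, by simpa using hmem 0⟩ : W.level l) =
      -⟨_, hmem N⟩ := by
    refine W.level_ext fun j => ?_
    rw [map_sub, map_sum, map_neg, sub_eq_iff_eq_add, neg_add_eq_sub, eq_sub_iff_add_eq]
    simpa [a] using (hc j).of_norm.sum_add_tsum_nat_add N
  rw [heq, norm_neg, ← (hdouble N).2, norm_def]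
  refine Summable.tsum_le_tsum (fun j => ?_) (hmem N) (hdouble N).1
  simpa using hterm N j

end WeightFamily

/-! ### Evaluation of the variables z -/

section Evaluation

variable {n : ℕ}

lemma tsum_sum_antidiagonal {A : Type*} [AddCommMonoid A] [Finset.HasAntidiagonal A]
    {F G : A → ℂ} (hF : Summable fun a => ‖F a‖) (hG : Summable fun a => ‖G a‖) :
    HasSum (fun a => ∑ q ∈ Finset.HasAntidiagonal.antidiagonal a, F q.1 * G q.2)
      ((∑' a, F a) * ∑' a, G a) := by
  have h := summable_mul_of_summable_norm hF hG
  rw [hF.of_norm.tsum_mul_tsum_eq_tsum_sum_antidiagonal hG.of_norm h]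
  exact (summable_sum_mul_antidiagonal_of_summable_mul h).hasSum

/-- Evaluation of the variables `z`. -/
noncomputable def evalZ (z : Fin n → ℂ) (f : MvPowerSeries (Fin (n + 1)) ℂ) : ℂ⟦X⟧ :=
  PowerSeries.mk fun j => ∑' α : Fin n →₀ ℕ,
    MvPowerSeries.coeff (Finsupp.cons j α) f * ∏ i, z i ^ α i

/-- Absolute convergence at the point `z`, for each power of `t` separately. -/
def ConvergesAt (z : Fin n → ℂ) (f : MvPowerSeries (Fin (n + 1)) ℂ) : Prop :=
  ∀ j, Summable fun α : Fin n →₀ ℕ => ‖MvPowerSeries.coeff (Finsupp.cons j α) f * ∏ i, z i ^ α i‖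

lemma coeff_evalZ (z : Fin n → ℂ) (f : MvPowerSeries (Fin (n + 1)) ℂ) (j : ℕ) :
    PowerSeries.coeff j (evalZ z f) = ∑' α : Fin n →₀ ℕ,
      MvPowerSeries.coeff (Finsupp.cons j α) f * ∏ i, z i ^ α i := PowerSeries.coeff_mk _ _

lemma coeff_cons_mul (f g : MvPowerSeries (Fin (n + 1)) ℂ) (j : ℕ) (α : Fin n →₀ ℕ) :
    MvPowerSeries.coeff (Finsupp.cons j α) (f * g) =
      ∑ p ∈ Finset.HasAntidiagonal.antidiagonal j, ∑ q ∈ Finset.HasAntidiagonal.antidiagonal α,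
        MvPowerSeries.coeff (Finsupp.cons p.1 q.1) f *
          MvPowerSeries.coeff (Finsupp.cons p.2 q.2) g := by
  classical
  have hadd : ∀ (a b : ℕ) (β γ : Fin n →₀ ℕ),
      Finsupp.cons a β + Finsupp.cons b γ = Finsupp.cons (a + b) (β + γ) := fun a b β γ => by
    ext i
    cases i using Fin.cases <;> simp
  rw [MvPowerSeries.coeff_mul, ← Finset.sum_product']
  refine Finset.sum_bij' (fun p _ => ((p.1 0, p.2 0), (Finsupp.tail p.1, Finsupp.tail p.2)))
    (fun p _ => (Finsupp.cons p.1.1 p.2.1, Finsupp.cons p.1.2 p.2.2)) ?_ ?_ ?_ ?_ ?_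
  · intro p hp
    rw [Finset.HasAntidiagonal.mem_antidiagonal] at hp
    simp only [Finset.mem_product, Finset.HasAntidiagonal.mem_antidiagonal]
    refine ⟨by rw [← Finsupp.add_apply, hp, Finsupp.cons_zero], ?_⟩
    ext i
    rw [← Finsupp.cons_succ (y := j) (s := α), ← hp]
    simp [Finsupp.tail_apply]
  · rintro ⟨p, q⟩ hp
    simp only [Finset.mem_product, Finset.HasAntidiagonal.mem_antidiagonal] at hp ⊢
    rw [hadd, hp.1, hp.2]
  · intro p _
    simp
  · intro p _
    simp
  · intro p _
    simp

lemma evalZ_add {z : Fin n → ℂ} {f g : MvPowerSeries (Fin (n + 1)) ℂ} (hf : ConvergesAt z f)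
    (hg : ConvergesAt z g) : evalZ z (f + g) = evalZ z f + evalZ z g := by
  ext j
  rw [map_add]
  simp only [coeff_evalZ, map_add, add_mul]
  exact (hf j).of_norm.tsum_add (hg j).of_norm

lemma evalZ_one (z : Fin n → ℂ) : evalZ z 1 = 1 := by
  classical
  ext j
  rw [coeff_evalZ, tsum_eq_single 0]
  · simp [MvPowerSeries.coeff_one, PowerSeries.coeff_one, Finsupp.cons_zero_eq_single_zero]
  · intro α hα
    rw [MvPowerSeries.coeff_one, if_neg (Finsupp.cons_ne_zero_of_right hα), zero_mul]

lemma evalZ_zero (z : Fin n → ℂ) : evalZ z 0 = 0 := by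
  ext j
  simp [coeff_evalZ]

lemma evalZ_mul {z : Fin n → ℂ} {f g : MvPowerSeries (Fin (n + 1)) ℂ} (hf : ConvergesAt z f)
    (hg : ConvergesAt z g) : evalZ z (f * g) = evalZ z f * evalZ z g := by
  classical
  ext j
  rw [PowerSeries.coeff_mul, coeff_evalZ]
  have hpow : ∀ α β : Fin n →₀ ℕ, ∏ i, z i ^ (α + β) i = (∏ i, z i ^ α i) * ∏ i, z i ^ β i :=
    fun α β => by simp [pow_add, Finset.prod_mul_distrib]
  let F : ℕ → (Fin n →₀ ℕ) → ℂ := fun a α =>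
    MvPowerSeries.coeff (Finsupp.cons a α) f * ∏ i, z i ^ α i
  let G : ℕ → (Fin n →₀ ℕ) → ℂ := fun a α =>
    MvPowerSeries.coeff (Finsupp.cons a α) g * ∏ i, z i ^ α i
  have h1 : ∀ α : Fin n →₀ ℕ, MvPowerSeries.coeff (Finsupp.cons j α) (f * g) * ∏ i, z i ^ α i =
      ∑ p ∈ Finset.HasAntidiagonal.antidiagonal j, ∑ q ∈ Finset.HasAntidiagonal.antidiagonal α,
        F p.1 q.1 * G p.2 q.2 := fun α => by
    rw [coeff_cons_mul, Finset.sum_mul]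
    refine Finset.sum_congr rfl fun p _ => ?_
    rw [Finset.sum_mul]
    refine Finset.sum_congr rfl fun q hq => ?_
    rw [← Finset.HasAntidiagonal.mem_antidiagonal.1 hq, hpow]
    simp only [F, G]
    ring
  have h2 := hasSum_sum (s := Finset.HasAntidiagonal.antidiagonal j) fun p _ =>
    tsum_sum_antidiagonal (F := F p.1) (G := G p.2) (hf p.1) (hg p.2)
  rw [tsum_congr h1, h2.tsum_eq]
  simp only [coeff_evalZ, F, G]

end Evaluation

/-! ### Convergent series as holomorphic functions with values in A_ĥ -/

namespace WeightFamily

variable {S : ℝ} {W : WeightFamily S} {n : ℕ} {h : ℝ}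

lemma summable_of_wnorm_lt_top {l : Set.Ioo (0 : ℝ) S} {ρ : Fin n → ℝ≥0}
    {f : MvPowerSeries (Fin (n + 1)) ℂ} (hf : wnorm (wt (W.u l) ρ) f < ⊤) :
    Summable fun p : ℕ × (Fin n →₀ ℕ) => ‖MvPowerSeries.coeff (Finsupp.cons p.1 p.2) f‖ *
      (∏ i, (ρ i : ℝ) ^ p.2 i) * W.w l p.1 := by
  have h1 := ENNReal.summable_toReal hf.ne
  rw [← (consExpEquiv n).summable_iff] at h1
  refine h1.congr fun p => ?_
  simp [wt, mul_assoc, mul_comm (W.w l p.1)]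

/-- The sum of the coefficients of `t ^ j` at radii `ρ`. -/
noncomputable def radialSum (ρ : Fin n → ℝ≥0) (f : MvPowerSeries (Fin (n + 1)) ℂ) (j : ℕ) : ℝ :=
  ∑' α : Fin n →₀ ℕ, ‖MvPowerSeries.coeff (Finsupp.cons j α) f‖ * ∏ i, (ρ i : ℝ) ^ α i

lemma summable_radial {l : Set.Ioo (0 : ℝ) S} {ρ : Fin n → ℝ≥0}
    {f : MvPowerSeries (Fin (n + 1)) ℂ} (hf : wnorm (wt (W.u l) ρ) f < ⊤) (j : ℕ) :
    Summable fun α : Fin n →₀ ℕ =>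
      ‖MvPowerSeries.coeff (Finsupp.cons j α) f‖ * ∏ i, (ρ i : ℝ) ^ α i := by
  have h1 := (summable_of_wnorm_lt_top hf).comp_injective (i := fun α : Fin n →₀ ℕ => (j, α))
    fun _ _ hh => by simpa using hh
  refine (h1.mul_right (W.w l j)⁻¹).congr fun α => ?_
  simp only [Function.comp_def]
  rw [mul_assoc, mul_inv_cancel₀ (W.pos l j).ne', mul_one]

lemma summable_radialSum {l : Set.Ioo (0 : ℝ) S} {ρ : Fin n → ℝ≥0}
    {f : MvPowerSeries (Fin (n + 1)) ℂ} (hf : wnorm (wt (W.u l) ρ) f < ⊤) :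
    Summable fun j => radialSum ρ f j * W.w l j := by
  have h1 := (summable_of_wnorm_lt_top hf).prod
  simp only [tsum_mul_right] at h1
  exact h1

lemma norm_monomial_le {ρ : Fin n → ℝ≥0} {z : Fin n → ℂ} (hz : ∀ i, ‖z i‖ ≤ ρ i)
    (f : MvPowerSeries (Fin (n + 1)) ℂ) (j : ℕ) (α : Fin n →₀ ℕ) :
    ‖MvPowerSeries.coeff (Finsupp.cons j α) f * ∏ i, z i ^ α i‖ ≤
      ‖MvPowerSeries.coeff (Finsupp.cons j α) f‖ * ∏ i, (ρ i : ℝ) ^ α i := by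
  rw [norm_mul, norm_prod]
  gcongr with i
  rw [norm_pow]
  gcongr
  exact hz i

lemma convergesAt_of_wnorm_lt_top {l : Set.Ioo (0 : ℝ) S} {ρ : Fin n → ℝ≥0}
    {f : MvPowerSeries (Fin (n + 1)) ℂ} (hf : wnorm (wt (W.u l) ρ) f < ⊤) {z : Fin n → ℂ}
    (hz : ∀ i, ‖z i‖ ≤ ρ i) : ConvergesAt z f := fun j =>
  Summable.of_nonneg_of_le (fun _ => norm_nonneg _) (norm_monomial_le hz f j) (summable_radial hf j)

lemma norm_coeff_evalZ_le {l : Set.Ioo (0 : ℝ) S} {ρ : Fin n → ℝ≥0}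
    {f : MvPowerSeries (Fin (n + 1)) ℂ} (hf : wnorm (wt (W.u l) ρ) f < ⊤) {z : Fin n → ℂ}
    (hz : ∀ i, ‖z i‖ ≤ ρ i) (j : ℕ) : ‖PowerSeries.coeff j (evalZ z f)‖ ≤ radialSum ρ f j := by
  rw [coeff_evalZ]
  exact (norm_tsum_le_tsum_norm (convergesAt_of_wnorm_lt_top hf hz j)).trans
    ((convergesAt_of_wnorm_lt_top hf hz j).tsum_le_tsum (norm_monomial_le hz f j)
      (summable_radial hf j))

lemma evalZ_mem_level {l : Set.Ioo (0 : ℝ) S} {ρ : Fin n → ℝ≥0}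
    {f : MvPowerSeries (Fin (n + 1)) ℂ} (hf : wnorm (wt (W.u l) ρ) f < ⊤) {z : Fin n → ℂ}
    (hz : ∀ i, ‖z i‖ ≤ ρ i) : evalZ z f ∈ W.level l :=
  Summable.of_nonneg_of_le (W.term_nonneg l _) (fun j =>
    mul_le_mul_of_nonneg_right (norm_coeff_evalZ_le hf hz j) (W.pos l j).le)
    (summable_radialSum hf)

lemma mem_hat_iff {f : ℂ⟦X⟧} : f ∈ W.hat h ↔
    ∀ l : Set.Ioo (0 : ℝ) S, (l : ℝ) < h → f ∈ W.level l := by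
  simp [hat, Algebra.mem_iInf]

lemma differentiableOn_coeff_evalZ {l : Set.Ioo (0 : ℝ) S} {ρ : Fin n → ℝ≥0} {r : ℝ} (hr : 0 < r)
    (hρ : ∀ i, r ≤ ρ i) {f : MvPowerSeries (Fin (n + 1)) ℂ} (hf : wnorm (wt (W.u l) ρ) f < ⊤)
    (j : ℕ) : DifferentiableOn ℂ (fun z => PowerSeries.coeff j (evalZ z f))
      (Metric.ball (0 : Fin n → ℂ) (r / 2)) := by
  simp only [coeff_evalZ]
  refine differentiableOn_tsum_of_norm_le hr (summable_radial hf j) (fun α => ?_) fun α z hz => ?_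
  · classical
    refine (Differentiable.const_mul ?_ _).differentiableOn
    exact fun z => (HasFDerivAt.finsetProd fun i _ =>
      ((differentiable_apply (𝕜 := ℂ) (F' := fun _ : Fin n => ℂ) i z).fun_pow
        (α i)).hasFDerivAt).differentiableAt
  · refine norm_monomial_le (fun i => ?_) f j α
    exact (norm_le_pi_norm z i).trans ((mem_ball_zero_iff.1 hz).le.trans (hρ i))

lemma X_pow_mem_level (l : Set.Ioo (0 : ℝ) S) (j : ℕ) :
    (PowerSeries.X : ℂ⟦X⟧) ^ j ∈ W.level l := by
  refine summable_of_ne_finset_zero (s := {j}) fun i hi => ?_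
  simp [term, PowerSeries.coeff_X_pow, Finset.notMem_singleton.1 hi]

lemma norm_X_pow (l : Set.Ioo (0 : ℝ) S) (j : ℕ) :
    ‖(⟨PowerSeries.X ^ j, X_pow_mem_level l j⟩ : W.level l)‖ = W.w l j := by
  rw [norm_def, tsum_eq_single j]
  · simp [PowerSeries.coeff_X_pow]
  · intro i hi
    simp [PowerSeries.coeff_X_pow, hi]

open Classical in
/-- The function with values in `A_ĥ` defined by a convergent power series. -/
noncomputable def evalHat (W : WeightFamily S) (h : ℝ) (f : MvPowerSeries (Fin (n + 1)) ℂ)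
    (z : Fin n → ℂ) : W.hat h :=
  -- The default value 0 is invisible to germs at the origin, where a series in `W.conv n h` always
  -- takes values in A_ĥ.
  if H : evalZ z f ∈ W.hat h then ⟨evalZ z f, H⟩ else 0

lemma coe_evalHat {f : MvPowerSeries (Fin (n + 1)) ℂ} {z : Fin n → ℂ} (H : evalZ z f ∈ W.hat h) :
    (W.evalHat h f z : ℂ⟦X⟧) = evalZ z f := by
  rw [evalHat, dif_pos H]

lemma exists_radius {f : MvPowerSeries (Fin (n + 1)) ℂ} (hf : f ∈ W.conv n h) :
    ∃ ρ : Fin n → ℝ≥0, ∃ r : ℝ, 0 < r ∧ (∀ i, r ≤ ρ i) ∧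
      ∀ l : Set.Ioo (0 : ℝ) S, (l : ℝ) < h → wnorm (wt (W.u l) ρ) f < ⊤ := by
  obtain ⟨ρ, hρ, hf⟩ := hf
  obtain ⟨r, hr, hr'⟩ : ∃ r : ℝ, 0 < r ∧ ∀ i, r ≤ ρ i := by
    refine Finite.induction_empty_option (P := fun ι => ∀ ρ : ι → ℝ≥0, (∀ i, 0 < ρ i) →
      ∃ r : ℝ, 0 < r ∧ ∀ i, r ≤ ρ i) ?_ ?_ ?_ (Fin n) ρ hρ
    · intro α β e H ρ hρ
      obtain ⟨r, hr, H⟩ := H (ρ ∘ e) fun i => hρ _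
      exact ⟨r, hr, fun i => by simpa using H (e.symm i)⟩
    · exact fun _ _ => ⟨1, one_pos, fun i => i.elim⟩
    · intro α _ H ρ hρ
      obtain ⟨r, hr, H⟩ := H (fun i => ρ (some i)) fun i => hρ _
      refine ⟨min r (ρ none), lt_min hr (hρ none), fun i => ?_⟩
      cases i with
      | none => exact min_le_right _ _
      | some i => exact (min_le_left _ _).trans (H i)
  exact ⟨ρ, r, hr, hr', hf⟩

/-- The ball comes from the polydisc alone and so serves all levels. Its radius is halved twice:
once for the sum over α that gives each coefficient, once for the sum over j that gives the value in
A_l. -/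
lemma exists_ball_evalHat (hh0 : 0 < h) (hh : h ≤ S) {f : MvPowerSeries (Fin (n + 1)) ℂ}
    (hf : f ∈ W.conv n h) : ∃ r : ℝ, 0 < r ∧
      (∀ z ∈ Metric.ball (0 : Fin n → ℂ) r, evalZ z f ∈ W.hat h ∧ ConvergesAt z f) ∧
      (∀ j, DifferentiableOn ℂ (fun z => PowerSeries.coeff j (evalZ z f))
        (Metric.ball (0 : Fin n → ℂ) r)) ∧
      ∀ (l : Set.Ioo (0 : ℝ) S) (hl : (l : ℝ) < h), DifferentiableOn ℂ
        (fun z => W.toLevel l hl (W.evalHat h f z)) (Metric.ball (0 : Fin n → ℂ) r) := by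
  obtain ⟨ρ, r, hr, hρ, hf⟩ := exists_radius hf
  obtain ⟨m, hm, hm'⟩ := exists_between hh0
  let l₀ : Set.Ioo (0 : ℝ) S := ⟨m, hm, hm'.trans_le hh⟩
  have hz : ∀ z ∈ Metric.ball (0 : Fin n → ℂ) r, ∀ i, ‖z i‖ ≤ ρ i := fun z hz i =>
    (norm_le_pi_norm z i).trans ((mem_ball_zero_iff.1 hz).le.trans (hρ i))
  have hhat : ∀ z ∈ Metric.ball (0 : Fin n → ℂ) r, evalZ z f ∈ W.hat h := fun z hz' =>
    mem_hat_iff.2 fun l hl => evalZ_mem_level (hf l hl) (hz z hz')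
  have hs1 : Metric.ball (0 : Fin n → ℂ) (r / 2 / 2) ⊆ Metric.ball 0 r :=
    Metric.ball_subset_ball (by linarith)
  have hs2 : Metric.ball (0 : Fin n → ℂ) (r / 2) ⊆ Metric.ball 0 r :=
    Metric.ball_subset_ball (by linarith)
  have hs3 : Metric.ball (0 : Fin n → ℂ) (r / 2 / 2) ⊆ Metric.ball 0 (r / 2) :=
    Metric.ball_subset_ball (by linarith)
  refine ⟨r / 2 / 2, by positivity, fun z hz' => ⟨hhat z (hs1 hz'),
    convergesAt_of_wnorm_lt_top (hf l₀ hm') (hz z (hs1 hz'))⟩,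
    fun j => (differentiableOn_coeff_evalZ hr hρ (hf l₀ hm') j).mono hs3, fun l hl => ?_⟩
  let T : ℕ → W.level l := fun j => ⟨PowerSeries.X ^ j, X_pow_mem_level l j⟩
  have hb : ∀ j, ∀ z ∈ Metric.ball (0 : Fin n → ℂ) (r / 2),
      ‖PowerSeries.coeff j (evalZ z f) • T j‖ ≤ radialSum ρ f j * W.w l j := fun j z hz' => by
    rw [norm_smul, norm_X_pow]
    exact mul_le_mul_of_nonneg_right (norm_coeff_evalZ_le (hf l hl) (hz z (hs2 hz')) j)
      (W.pos l j).le
  refine (differentiableOn_tsum_of_norm_le (half_pos hr) (summable_radialSum (hf l hl))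
    (fun j => (differentiableOn_coeff_evalZ hr hρ (hf l hl) j).smul_const (T j)) hb).congr
    fun z hz' => ?_
  have hsum : Summable fun j => PowerSeries.coeff j (evalZ z f) • T j :=
    Summable.of_norm_bounded (summable_radialSum (hf l hl)) fun j => hb j z (hs3 hz')
  refine W.level_ext fun i => ?_
  rw [(W.coeffCLM l i).map_tsum hsum, tsum_eq_single i]
  · rw [map_smul, coeffCLM_apply, coeffCLM_apply]
    change PowerSeries.coeff i (W.evalHat h f z : ℂ⟦X⟧) = _
    rw [coe_evalHat (hhat z (hs1 hz'))]
    simp [T, PowerSeries.coeff_X_pow]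
  · intro j hj
    rw [map_smul, coeffCLM_apply]
    simp [T, PowerSeries.coeff_X_pow, hj.symm]

end WeightFamily

/-! ### From Cauchy estimates to convergent series -/

namespace WeightFamily

variable {S : ℝ} {W : WeightFamily S} {n : ℕ} {h : ℝ}

/-- Passing to a higher level makes the sequence of ratios of the weights summable. -/
lemma exists_summable_ratio (hh : h ≤ S) (l : Set.Ioo (0 : ℝ) S) (hl : (l : ℝ) < h) :
    ∃ l' : Set.Ioo (0 : ℝ) S, (l' : ℝ) < h ∧ Summable fun j => W.w l j / W.w l' j := by
  -- One application of nuclearity bounds the ratio by a multiple of j⁻¹, which is not summable; an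
  -- intermediate level allows two applications and gives j⁻².
  obtain ⟨l₁, h1, hl₁⟩ := exists_level_between hh l hl
  obtain ⟨l₂, h2, hl₂⟩ := exists_level_between hh l₁ hl₁
  obtain ⟨K₁, hK₁, H₁⟩ := W.nuclearity l l₁ h1
  obtain ⟨K₂, hK₂, H₂⟩ := W.nuclearity l₁ l₂ h2
  have hle : ∀ {a b : Set.Ioo (0 : ℝ) S} {K : ℝ}, 0 < K → (∀ j : ℕ, 1 ≤ j →
      W.w a j ≤ K * min ((j : ℝ)⁻¹) (W.w b (j + 1) / W.w b j) * W.w b j) →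
      ∀ j : ℕ, 1 ≤ j → W.w a j ≤ K * (j : ℝ)⁻¹ * W.w b j := by
    intro a b K hK H j hj
    refine (H j hj).trans ?_
    have := (W.pos b j).le
    gcongr
    exact min_le_left _ _
  refine ⟨l₂, hl₂, ?_⟩
  rw [← summable_nat_add_iff 1]
  have hs : Summable fun j : ℕ => K₁ * K₂ * (((j + 1 : ℕ) : ℝ) ^ 2)⁻¹ :=
    ((summable_nat_add_iff 1).2 (Real.summable_nat_pow_inv.2 one_lt_two)).mul_left _
  refine Summable.of_nonneg_of_le (fun j => (div_pos (W.pos _ _) (W.pos _ _)).le) (fun j => ?_) hs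
  rw [div_le_iff₀ (W.pos _ _)]
  have hj : (0 : ℝ) < ((j + 1 : ℕ) : ℝ) := by positivity
  calc W.w l (j + 1) ≤ K₁ * (((j + 1 : ℕ) : ℝ))⁻¹ * W.w l₁ (j + 1) :=
        hle hK₁ H₁ _ (Nat.le_add_left 1 j)
    _ ≤ K₁ * (((j + 1 : ℕ) : ℝ))⁻¹ * (K₂ * (((j + 1 : ℕ) : ℝ))⁻¹ * W.w l₂ (j + 1)) := by
        gcongr
        exact hle hK₂ H₂ _ (Nat.le_add_left 1 j)
    _ = _ := by rw [sq, mul_inv]; ring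

lemma summable_mul_prod {A : Type*} {f : ℕ → ℝ} {g : A → ℝ} (hf : Summable f) (hg : Summable g)
    (hf0 : ∀ j, 0 ≤ f j) (hg0 : ∀ a, 0 ≤ g a) : Summable fun p : ℕ × A => f p.1 * g p.2 :=
  hf.mul_of_nonneg hg hf0 hg0

/-- Cauchy estimates at every level give a convergent series. -/
lemma mem_conv_of_cauchy_estimates (hh : h ≤ S) {c : ℕ → (Fin n →₀ ℕ) → ℂ} {r : ℝ} (hr0 : 0 < r)
    (hC : ∀ l : Set.Ioo (0 : ℝ) S, (l : ℝ) < h → ∃ C : ℝ, 0 ≤ C ∧ ∀ j (α : Fin n →₀ ℕ),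
      ‖c j α‖ * (∏ i, r ^ α i) * W.w l j ≤ C) {f : MvPowerSeries (Fin (n + 1)) ℂ}
    (hf : ∀ j (α : Fin n →₀ ℕ), MvPowerSeries.coeff (Finsupp.cons j α) f = c j α) :
    f ∈ W.conv n h := by
  have hr2 : (0 : ℝ) < r / 2 := half_pos hr0
  -- Halving the radius makes the sum over α geometric, and the estimate at the higher level `l'`
  -- makes the sum over j converge. The radius does not depend on `l`.
  refine ⟨fun _ => (r / 2).toNNReal, fun _ => Real.toNNReal_pos.2 hr2, fun l hl => ?_⟩
  obtain ⟨l', hl', hs⟩ := exists_summable_ratio (W := W) hh l hl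
  obtain ⟨C, hC0, hC⟩ := hC l' hl'
  have hgeom : Summable fun α : Fin n →₀ ℕ => ∏ i, (1 / 2 : ℝ) ^ α i :=
    summable_prod_pow (fun _ => by norm_num) fun _ => by norm_num
  have hprod := summable_mul_prod hs hgeom (fun j => (div_pos (W.pos _ _) (W.pos _ _)).le)
    fun α => Finset.prod_nonneg fun i _ => by positivity
  have hsum : Summable fun d : Fin (n + 1) →₀ ℕ => ‖MvPowerSeries.coeff d f‖ *
      (wt (W.u l) (fun _ => (r / 2).toNNReal) d : ℝ) := by
    rw [← (consExpEquiv n).summable_iff]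
    refine Summable.of_nonneg_of_le (fun p => by simp only [Function.comp_apply]; positivity)
      (fun p => ?_) (hprod.mul_left C)
    have hp := W.pos l' p.1
    have hp' := W.pos l p.1
    have h3 : wt (W.u l) (fun _ => (r / 2).toNNReal) (Finsupp.cons p.1 p.2) =
        W.w l p.1 * ((∏ i, r ^ p.2 i) * ∏ i, (1 / 2 : ℝ) ^ p.2 i) := by
      rw [← Finset.prod_mul_distrib]
      simp only [wt, NNReal.coe_mul, NNReal.coe_prod, NNReal.coe_pow, Real.coe_toNNReal _ hr2.le,
        Finsupp.cons_zero, Finsupp.cons_succ, coe_u, ← mul_pow]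
      congr! 3
      ring
    simp only [Function.comp_apply, consExpEquiv_apply, hf, h3]
    calc _ = ‖c p.1 p.2‖ * (∏ i, r ^ p.2 i) * W.w l' p.1 *
          (W.w l p.1 / W.w l' p.1 * ∏ i, (1 / 2 : ℝ) ^ p.2 i) := by field_simp
      _ ≤ C * (W.w l p.1 / W.w l' p.1 * ∏ i, (1 / 2 : ℝ) ^ p.2 i) := by
          gcongr
          exact hC _ _
  have h4 : ∀ d, ‖MvPowerSeries.coeff d f‖ₑ *
      (wt (W.u l) (fun _ => (r / 2).toNNReal) d : ℝ≥0∞) = ENNReal.ofReal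
      (‖MvPowerSeries.coeff d f‖ * (wt (W.u l) (fun _ => (r / 2).toNNReal) d : ℝ)) := fun d => by
    rw [ENNReal.ofReal_mul (norm_nonneg _), ofReal_norm, ENNReal.ofReal_coe_nnreal]
  unfold wnorm
  simp_rw [h4]
  exact hsum.tsum_ofReal_lt_top

/-! ### The stalk in local coordinates -/

section Manifold

variable {E : Type*} [NormedAddCommGroup E] [NormedSpace ℂ E]
  {M : Type*} [TopologicalSpace M] [ChartedSpace E M] {x : M}

/-- Coordinates centred at `x` with values in `ℂⁿ`. -/
noncomputable def coord (b : E ≃L[ℂ] (Fin n → ℂ)) (x y : M) : Fin n → ℂ :=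
  b (chartAt E x y - chartAt E x x)

/-- The inverse of the coordinates centred at `x`. -/
noncomputable def coordInv (b : E ≃L[ℂ] (Fin n → ℂ)) (x : M) (z : Fin n → ℂ) : M :=
  (chartAt E x).symm (b.symm z + chartAt E x x)

@[simp] lemma coord_self (b : E ≃L[ℂ] (Fin n → ℂ)) (x : M) : coord b x x = 0 := by
  simp [coord]

lemma continuousOn_coord (b : E ≃L[ℂ] (Fin n → ℂ)) (x : M) :
    ContinuousOn (coord b x) (chartAt E x).source :=
  b.continuous.comp_continuousOn ((chartAt E x).continuousOn.sub continuousOn_const)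

lemma tendsto_coord (b : E ≃L[ℂ] (Fin n → ℂ)) (x : M) :
    Filter.Tendsto (coord b x) (𝓝 x) (𝓝 0) := by
  have := (continuousOn_coord b x).continuousAt ((chartAt E x).open_source.mem_nhds
    (mem_chart_source E x))
  rw [ContinuousAt, coord_self] at this
  exact this

lemma tendsto_shift (b : E ≃L[ℂ] (Fin n → ℂ)) (x : M) :
    Filter.Tendsto (fun z => b.symm z + chartAt E x x) (𝓝 0) (𝓝 (chartAt E x x)) := by
  have : Continuous fun z => b.symm z + chartAt E x x := by fun_prop
  simpa using this.tendsto 0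

lemma eventually_mem_target (b : E ≃L[ℂ] (Fin n → ℂ)) (x : M) :
    ∀ᶠ z in 𝓝 (0 : Fin n → ℂ), b.symm z + chartAt E x x ∈ (chartAt E x).target :=
  (tendsto_shift b x).eventually ((chartAt E x).open_target.mem_nhds (mem_chart_target E x))

lemma tendsto_coordInv (b : E ≃L[ℂ] (Fin n → ℂ)) (x : M) :
    Filter.Tendsto (coordInv b x) (𝓝 0) (𝓝 x) := by
  have h1 := (chartAt E x).continuousAt_symm (mem_chart_target E x)
  rw [ContinuousAt, (chartAt E x).left_inv (mem_chart_source E x)] at h1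
  exact h1.comp (tendsto_shift b x)

lemma coord_coordInv {b : E ≃L[ℂ] (Fin n → ℂ)} {x : M} {z : Fin n → ℂ}
    (hz : b.symm z + chartAt E x x ∈ (chartAt E x).target) : coord b x (coordInv b x z) = z := by
  simp [coord, coordInv, (chartAt E x).right_inv hz]

lemma coordInv_coord {b : E ≃L[ℂ] (Fin n → ℂ)} {x y : M} (hy : y ∈ (chartAt E x).source) :
    coordInv b x (coord b x y) = y := by
  simp [coord, coordInv, (chartAt E x).left_inv hy]

lemma holomorphicOn_comp_coord [IsManifold 𝓘(ℂ, E) ω M] (b : E ≃L[ℂ] (Fin n → ℂ)) (x : M) {r : ℝ}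
    {f : (Fin n → ℂ) → W.hat h}
    (hf : ∀ (l : Set.Ioo (0 : ℝ) S) (hl : (l : ℝ) < h),
      DifferentiableOn ℂ (fun z => W.toLevel l hl (f z)) (Metric.ball 0 r)) :
    W.HolomorphicOn E (fun y => f (coord b x y))
      ((chartAt E x).source ∩ coord b x ⁻¹' Metric.ball 0 r) := by
  intro l hl y hy
  have _ : IsManifold 𝓘(ℂ, E) 1 M := IsManifold.of_le (n := ω) le_top
  have h1 : MDifferentiableAt 𝓘(ℂ, E) 𝓘(ℂ, E) (chartAt E x) y :=
    mdifferentiableAt_atlas (chart_mem_atlas E x) hy.1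
  have h2 : DifferentiableAt ℂ (fun v : E => W.toLevel l hl (f (b (v - chartAt E x x))))
      (chartAt E x y) := by
    have h3 : DifferentiableAt ℂ (fun z => W.toLevel l hl (f z)) (coord b x y) :=
      (hf l hl).differentiableAt (Metric.isOpen_ball.mem_nhds hy.2)
    have h4 : DifferentiableAt ℂ (fun v : E => b (v - chartAt E x x)) (chartAt E x y) := by fun_prop
    exact DifferentiableAt.comp (g := fun z => W.toLevel l hl (f z)) _ h3 h4
  exact (h2.mdifferentiableAt.comp y h1).mdifferentiableWithinAt

lemma differentiableOn_comp_coordInv [IsManifold 𝓘(ℂ, E) ω M] (b : E ≃L[ℂ] (Fin n → ℂ)) (x : M)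
    {U : Set M} (hU : IsOpen U) (hxU : x ∈ U) {f : M → W.hat h} (hf : W.HolomorphicOn E f U) :
    ∃ r : ℝ, 0 < r ∧ ∀ (l : Set.Ioo (0 : ℝ) S) (hl : (l : ℝ) < h),
      DifferentiableOn ℂ (fun z => W.toLevel l hl (f (coordInv b x z))) (Metric.ball 0 r) := by
  have hev : ∀ᶠ z in 𝓝 (0 : Fin n → ℂ), b.symm z + chartAt E x x ∈ (chartAt E x).target ∧
      coordInv b x z ∈ U :=
    (eventually_mem_target b x).and ((tendsto_coordInv b x).eventually (hU.mem_nhds hxU))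
  obtain ⟨r, hr, hrU⟩ := Metric.eventually_nhds_iff_ball.1 hev
  refine ⟨r, hr, fun l hl z hz => ?_⟩
  have _ : IsManifold 𝓘(ℂ, E) 1 M := IsManifold.of_le (n := ω) le_top
  obtain ⟨hzt, hzU⟩ := hrU z hz
  have h1 : MDifferentiableAt 𝓘(ℂ, E) 𝓘(ℂ, E) (chartAt E x).symm (b.symm z + chartAt E x x) :=
    mdifferentiableAt_atlas_symm (chart_mem_atlas E x) hzt
  have h2 : MDifferentiableAt 𝓘(ℂ, E) 𝓘(ℂ, W.level l) (fun y => W.toLevel l hl (f y))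
      ((chartAt E x).symm (b.symm z + chartAt E x x)) :=
    (hf l hl).mdifferentiableAt (hU.mem_nhds hzU)
  have h3 : DifferentiableAt ℂ (fun v : E => W.toLevel l hl (f ((chartAt E x).symm v)))
      (b.symm z + chartAt E x x) :=
    (MDifferentiableAt.comp (g := fun y => W.toLevel l hl (f y))
      (f := (chartAt E x).symm) _ h2 h1).differentiableAt
  have h4 : DifferentiableAt ℂ (fun z => b.symm z + chartAt E x x) z := by fun_prop
  exact (h3.comp z h4).differentiableWithinAt

lemma isOpen_coord_preimage (b : E ≃L[ℂ] (Fin n → ℂ)) (x : M) (r : ℝ) :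
    IsOpen ((chartAt E x).source ∩ coord b x ⁻¹' Metric.ball 0 r) :=
  (continuousOn_coord b x).isOpen_inter_preimage (chartAt E x).open_source Metric.isOpen_ball

lemma eventually_evalZ (hh0 : 0 < h) (hh : h ≤ S) (b : E ≃L[ℂ] (Fin n → ℂ)) (x : M)
    (f : W.conv n h) :
    ∀ᶠ y in 𝓝 x, evalZ (coord b x y) f.1 ∈ W.hat h ∧ ConvergesAt (coord b x y) f.1 := by
  obtain ⟨r, hr, h1, -⟩ := exists_ball_evalHat hh0 hh f.2
  filter_upwards [(tendsto_coord b x).eventually (Metric.ball_mem_nhds 0 hr)] with y hy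
  exact h1 _ hy

/-- The germ at `x` of the function defined by a convergent power series. -/
noncomputable def convGerm [IsManifold 𝓘(ℂ, E) ω M] (hh0 : 0 < h) (hh : h ≤ S)
    (b : E ≃L[ℂ] (Fin n → ℂ)) (x : M) : W.conv n h →+* W.stalk E h x where
  toFun f := ⟨((fun y => W.evalHat h f.1 (coord b x y) : M → W.hat h) :
      Filter.Germ (𝓝 x) (W.hat h)), by
    obtain ⟨r, hr, -, -, h2⟩ := exists_ball_evalHat hh0 hh f.2
    exact ⟨_, isOpen_coord_preimage b x r, ⟨mem_chart_source E x, by simpa using hr⟩, _,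
      holomorphicOn_comp_coord b x h2, rfl⟩⟩
  map_one' := by
    refine Subtype.ext (Filter.Germ.coe_eq.2 ?_)
    filter_upwards [eventually_evalZ hh0 hh b x (1 : W.conv n h)] with y hy
    refine Subtype.ext ?_
    rw [coe_evalHat hy.1]
    exact evalZ_one _
  map_zero' := by
    refine Subtype.ext (Filter.Germ.coe_eq.2 ?_)
    filter_upwards [eventually_evalZ hh0 hh b x (0 : W.conv n h)] with y hy
    refine Subtype.ext ?_
    rw [coe_evalHat hy.1]
    exact evalZ_zero _
  map_mul' f g := by
    refine Subtype.ext (Filter.Germ.coe_eq.2 ?_)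
    filter_upwards [eventually_evalZ hh0 hh b x f, eventually_evalZ hh0 hh b x g,
      eventually_evalZ hh0 hh b x (f * g)] with y hf hg hfg
    refine Subtype.ext ?_
    rw [coe_evalHat hfg.1]
    refine (evalZ_mul hf.2 hg.2).trans ?_
    rw [← coe_evalHat hf.1, ← coe_evalHat hg.1]
    rfl
  map_add' f g := by
    refine Subtype.ext (Filter.Germ.coe_eq.2 ?_)
    filter_upwards [eventually_evalZ hh0 hh b x f, eventually_evalZ hh0 hh b x g,
      eventually_evalZ hh0 hh b x (f + g)] with y hf hg hfg
    refine Subtype.ext ?_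
    rw [coe_evalHat hfg.1]
    refine (evalZ_add hf.2 hg.2).trans ?_
    rw [← coe_evalHat hf.1, ← coe_evalHat hg.1]
    rfl

variable [IsManifold 𝓘(ℂ, E) ω M]

/-- A series whose values vanish near the origin in degree `j` in `t` has no terms of this
degree. -/
lemma coeff_eq_zero_of_eventually {f : MvPowerSeries (Fin (n + 1)) ℂ} {j : ℕ}
    (hf : ∀ᶠ z in 𝓝 (0 : Fin n → ℂ), ConvergesAt z f ∧ PowerSeries.coeff j (evalZ z f) = 0)
    (α : Fin n →₀ ℕ) : MvPowerSeries.coeff (Finsupp.cons j α) f = 0 := by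
  obtain ⟨r, hr, hrf⟩ := Metric.eventually_nhds_iff_ball.1 hf
  refine eq_zero_of_hasSum_monomials (c := fun α => MvPowerSeries.coeff (Finsupp.cons j α) f) hr
    (fun z hz => ?_) α
  obtain ⟨h1, h2⟩ := hrf z (by rw [mem_ball_zero_iff, pi_norm_lt_iff hr]; exact hz)
  refine ⟨h1 j, ?_⟩
  rw [← h2, coeff_evalZ]
  exact (h1 j).of_norm.hasSum

lemma convGerm_injective (hh0 : 0 < h) (hh : h ≤ S) (b : E ≃L[ℂ] (Fin n → ℂ)) (x : M) :
    Function.Injective (convGerm (W := W) hh0 hh b x) := by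
  rw [injective_iff_map_eq_zero]
  intro f hf
  have h1 : ∀ᶠ y in 𝓝 x, W.evalHat h f.1 (coord b x y) = 0 :=
    Filter.Germ.coe_eq.1 (congrArg Subtype.val hf)
  have h2 := ((tendsto_coordInv b x).eventually (h1.and (eventually_evalZ hh0 hh b x f))).and
    (eventually_mem_target b x)
  refine Subtype.ext (MvPowerSeries.ext fun d => ?_)
  rw [← Finsupp.cons_tail d]
  refine coeff_eq_zero_of_eventually ?_ _
  filter_upwards [h2] with z hz
  obtain ⟨⟨h3, h4, h5⟩, h6⟩ := hz
  rw [coord_coordInv h6] at h3 h4 h5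
  refine ⟨h5, ?_⟩
  rw [← coe_evalHat h4, h3]
  simp

/-- Each t-coefficient of the function is a scalar holomorphic function on one common ball. Its
Taylor coefficients satisfy Cauchy estimates at level l, since the A_l-valued function is bounded on
a compact polydisc. -/
lemma convGerm_surjective (hh0 : 0 < h) (hh : h ≤ S) (b : E ≃L[ℂ] (Fin n → ℂ)) (x : M) :
    Function.Surjective (convGerm (W := W) hh0 hh b x) := by
  rintro ⟨_, U, hU, hxU, F, hF, rfl⟩
  obtain ⟨R, hR, hFR⟩ := differentiableOn_comp_coordInv b x hU hxU hF
  set G : (Fin n → ℂ) → W.hat h := fun z => F (coordInv b x z) with hG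
  set r := R / 2 with hr
  have hr0 : 0 < r := half_pos hR
  have hball : ∀ z : Fin n → ℂ, (∀ i, ‖z i‖ ≤ r) → z ∈ Metric.ball (0 : Fin n → ℂ) R := by
    intro z hz
    rw [mem_ball_zero_iff]
    exact ((pi_norm_le_iff_of_nonneg hr0.le).2 hz).trans_lt (half_lt_self hR)
  obtain ⟨m, hm, hm'⟩ := exists_between hh0
  let l₀ : Set.Ioo (0 : ℝ) S := ⟨m, hm, hm'.trans_le hh⟩
  have hcoeff : ∀ j, DifferentiableOn ℂ (fun z => PowerSeries.coeff j (G z).1)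
      (Metric.ball 0 R) := fun j =>
    (W.coeffCLM l₀ j).differentiable.comp_differentiableOn (hFR l₀ hm')
  -- The level `l₀` only served to see that the coefficients are holomorphic; `c` itself is
  -- independent of the level.
  choose c hcb hcs using fun j => exists_taylor_polydisc hr0 Metric.isOpen_ball hball (hcoeff j)
  have hC : ∀ (l : Set.Ioo (0 : ℝ) S), (l : ℝ) < h → ∃ C : ℝ, 0 ≤ C ∧ ∀ j (α : Fin n →₀ ℕ),
      ‖c j α‖ * (∏ i, r ^ α i) * W.w l j ≤ C := by
    intro l hl
    have hcomp : IsCompact (Metric.closedBall (0 : Fin n → ℂ) r) := isCompact_closedBall _ _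
    obtain ⟨C, hC⟩ := hcomp.exists_bound_of_continuousOn ((hFR l hl).continuousOn.mono
      (Metric.closedBall_subset_ball (half_lt_self hR)))
    have hC0 : 0 ≤ C := (norm_nonneg _).trans (hC 0 (Metric.mem_closedBall_self hr0.le))
    refine ⟨C, hC0, fun j α => ?_⟩
    rw [← le_div_iff₀ (W.pos l j)]
    refine hcb j _ (fun z hz => ?_) α
    rw [le_div_iff₀ (W.pos l j)]
    refine (W.norm_coeff_le l (W.toLevel l hl (G z)) j).trans (hC z ?_)
    rw [mem_closedBall_zero_iff]
    exact (pi_norm_le_iff_of_nonneg hr0.le).2 hz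
  let f : MvPowerSeries (Fin (n + 1)) ℂ := fun d => c (d 0) (Finsupp.tail d)
  have hf : ∀ j (α : Fin n →₀ ℕ), MvPowerSeries.coeff (Finsupp.cons j α) f = c j α := fun j α => by
    change c ((Finsupp.cons j α : Fin (n + 1) →₀ ℕ) 0) (Finsupp.tail (Finsupp.cons j α)) = _
    simp
  have hfc : f ∈ W.conv n h := mem_conv_of_cauchy_estimates hh hr0 hC hf
  refine ⟨⟨f, hfc⟩, Subtype.ext (Filter.Germ.coe_eq.2 ?_)⟩
  filter_upwards [eventually_evalZ hh0 hh b x ⟨f, hfc⟩, (chartAt E x).open_source.mem_nhds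
    (mem_chart_source E x), (tendsto_coord b x).eventually (Metric.ball_mem_nhds 0 hr0)]
    with y hy hys hyr
  refine Subtype.ext (PowerSeries.ext fun j => ?_)
  rw [coe_evalHat hy.1, coeff_evalZ]
  simp only [hf]
  rw [(hcs j (coord b x y) fun i => (norm_le_pi_norm _ i).trans_lt
    (mem_ball_zero_iff.1 hyr)).tsum_eq, hG]
  simp only [coordInv_coord hys]

/-- The stalk is isomorphic to the ring of convergent power series. -/
noncomputable def convEquiv (hh0 : 0 < h) (hh : h ≤ S) (b : E ≃L[ℂ] (Fin n → ℂ)) (x : M) :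
    W.conv n h ≃+* W.stalk E h x :=
  RingEquiv.ofBijective (convGerm hh0 hh b x)
    ⟨convGerm_injective hh0 hh b x, convGerm_surjective hh0 hh b x⟩

end Manifold

end WeightFamily

/-! ### Linear changes of variables and regularity -/

namespace WeightFamily

variable {S : ℝ} {W : WeightFamily S} {n : ℕ} {h : ℝ}

lemma coord_modelSpace {E : Type*} [NormedAddCommGroup E] [NormedSpace ℂ E]
    (b : E ≃L[ℂ] (Fin n → ℂ)) (y : E) : coord b (0 : E) y = b y := by
  rw [coord, chartAt_self_eq]
  simp

/-- The automorphism of the ring of convergent series induced by a linear change of the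
variables `z`. -/
noncomputable def linearChange (hh0 : 0 < h) (hh : h ≤ S)
    (L : (Fin n → ℂ) ≃L[ℂ] (Fin n → ℂ)) : W.conv n h ≃+* W.conv n h :=
  -- The same germ on ℂⁿ is expanded in two systems of linear coordinates; convergence after the
  -- substitution then needs no estimate.
  (convEquiv hh0 hh (.refl ℂ (Fin n → ℂ)) (0 : Fin n → ℂ)).trans
    (convEquiv hh0 hh L (0 : Fin n → ℂ)).symm

lemma eventually_evalZ_linearChange (hh0 : 0 < h) (hh : h ≤ S)
    (L : (Fin n → ℂ) ≃L[ℂ] (Fin n → ℂ)) (f : W.conv n h) :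
    ∀ᶠ y in 𝓝 (0 : Fin n → ℂ), evalZ (L y) (linearChange hh0 hh L f).1 = evalZ y f.1 := by
  have h1 : convGerm hh0 hh L (0 : Fin n → ℂ) (linearChange hh0 hh L f) =
      convGerm hh0 hh (.refl ℂ (Fin n → ℂ)) (0 : Fin n → ℂ) f :=
    (convEquiv hh0 hh L (0 : Fin n → ℂ)).apply_symm_apply _
  have h2 := Filter.Germ.coe_eq.1 (congrArg Subtype.val h1)
  filter_upwards [h2, eventually_evalZ hh0 hh L (0 : Fin n → ℂ) (linearChange hh0 hh L f),
    eventually_evalZ hh0 hh (.refl ℂ (Fin n → ℂ)) (0 : Fin n → ℂ) f] with y hy h3 h4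
  have h5 := congrArg Subtype.val hy
  rw [coe_evalHat h3.1, coe_evalHat h4.1] at h5
  rwa [coord_modelSpace, coord_modelSpace] at h5

/-- On the last axis only the pure powers of the last variable survive in the t-free part. -/
lemma coeff_zero_evalZ_single {f : MvPowerSeries (Fin (n + 1 + 1)) ℂ}
    (hf : ∀ m, MvPowerSeries.coeff (Finsupp.single (Fin.last _) m) f = 0) (c : ℂ) :
    PowerSeries.coeff 0 (evalZ (Pi.single (Fin.last n) c) f) = 0 := by
  rw [coeff_evalZ]
  refine (tsum_congr fun α => ?_).trans tsum_zero
  by_cases hα : ∀ i, i ≠ Fin.last n → α i = 0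
  · have : Finsupp.cons 0 α = Finsupp.single (Fin.last (n + 1)) (α (Fin.last n)) := by
      ext i
      cases i using Fin.cases with
      | zero => simp
      | succ i =>
        rw [Finsupp.cons_succ, ← Fin.succ_last, Finsupp.single_apply]
        by_cases hi : i = Fin.last n
        · simp [hi]
        · rw [hα i hi, if_neg (by rw [Fin.succ_inj]; exact Ne.symm hi)]
    rw [this, hf, zero_mul]
  · push Not at hα
    obtain ⟨i, hi, hi0⟩ := hα
    rw [Finset.prod_eq_zero (Finset.mem_univ i), mul_zero]
    rw [Pi.single_eq_of_ne hi, zero_pow hi0]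

/-- A series that does not vanish modulo `t` becomes regular in the last variable after a linear
change of the variables `z`. -/
lemma exists_linearChange_regular (hh0 : 0 < h) (hh : h ≤ S) {g : W.conv (n + 1) h}
    {d : Fin (n + 1 + 1) →₀ ℕ} (hd : d 0 = 0) (hg : MvPowerSeries.coeff d g.1 ≠ 0) :
    ∃ (L : (Fin (n + 1) → ℂ) ≃L[ℂ] (Fin (n + 1) → ℂ)) (m : ℕ),
      MvPowerSeries.coeff (Finsupp.single (Fin.last _) m) (linearChange hh0 hh L g).1 ≠ 0 := by
  obtain ⟨r, hr, h1, h2, -⟩ := exists_ball_evalHat hh0 hh g.2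
  -- `L` will move the line through `v`, on which the t-free part of g is not identically zero, to
  -- the last axis. If `v = 0`, the constant term is nonzero and any `L` will do.
  obtain ⟨v, hv, hv0⟩ : ∃ v ∈ Metric.ball (0 : Fin (n + 1) → ℂ) r,
      PowerSeries.coeff 0 (evalZ v g.1) ≠ 0 := by
    by_contra! H
    refine hg ?_
    rw [← Finsupp.cons_tail d, hd]
    refine coeff_eq_zero_of_eventually ?_ _
    filter_upwards [Metric.ball_mem_nhds 0 hr] with z hz
    exact ⟨(h1 z hz).2, H z hz⟩
  obtain ⟨L, c, hL⟩ : ∃ (L : (Fin (n + 1) → ℂ) ≃L[ℂ] (Fin (n + 1) → ℂ)) (c : ℂ),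
      L v = Pi.single (Fin.last n) c := by
    by_cases hv : v = 0
    · exact ⟨.refl ℂ _, 0, by simp [hv]⟩
    · obtain ⟨L, hL⟩ := SeparatingDual.exists_continuousLinearEquiv_apply_eq (R := ℂ) (x := v)
        (y := Pi.single (Fin.last n) (1 : ℂ)) hv (by simp)
      exact ⟨L, 1, hL⟩
  refine ⟨L, ?_⟩
  by_contra! H
  refine hv0 ?_
  -- If no pure power of the last variable occurred, the t-free part would vanish at s v for s near
  -- 0, hence on the convex set `D` by the identity theorem, and in particular at s = 1.
  set D : Set ℂ := (fun s : ℂ => s • v) ⁻¹' Metric.ball 0 r with hD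
  have hcont : Continuous fun s : ℂ => s • v := by fun_prop
  have hDo : IsOpen D := Metric.isOpen_ball.preimage hcont
  have hDc : Convex ℝ D := by
    have := (convex_ball (0 : Fin (n + 1) → ℂ) r).linear_preimage
      ((LinearMap.toSpanSingleton ℂ (Fin (n + 1) → ℂ) v).restrictScalars ℝ)
    exact this
  have h0D : (0 : ℂ) ∈ D := by simp [hD, hr]
  have h1D : (1 : ℂ) ∈ D := by simpa [hD] using hv
  have hdiff : DifferentiableOn ℂ (fun s : ℂ => PowerSeries.coeff 0 (evalZ (s • v) g.1)) D :=
    (h2 0).comp (by fun_prop) fun s hs => hs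
  have hev : (fun s : ℂ => PowerSeries.coeff 0 (evalZ (s • v) g.1)) =ᶠ[𝓝 0] 0 := by
    have h3 : Filter.Tendsto (fun s : ℂ => s • v) (𝓝 0) (𝓝 0) := by
      simpa using hcont.tendsto 0
    filter_upwards [h3.eventually (eventually_evalZ_linearChange hh0 hh L g)] with s hs
    rw [← hs, map_smul, hL, ← Pi.single_smul]
    exact coeff_zero_evalZ_single H _
  have := (hdiff.analyticOnNhd hDo).eqOn_zero_of_preconnected_of_eventuallyEq_zero
    hDc.isPreconnected h0D hev h1D
  simpa using this

lemma rename_castSucc_mem_conv {f : MvPowerSeries (Fin (n + 1)) ℂ} (hf : f ∈ W.conv n h) :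
    MvPowerSeries.rename (Fin.castSuccEmb : Fin (n + 1) ↪ Fin (n + 1 + 1)) f ∈ W.conv (n + 1) h := by
  obtain ⟨ρ, hρ, hf⟩ := hf
  -- The new variable does not occur in the series, so any positive radius serves for it.
  refine ⟨Fin.snoc ρ 1, fun i => ?_, fun l hl => lt_of_le_of_lt (le_of_eq ?_) (hf l hl)⟩
  · cases i using Fin.lastCases with
    | last => simp
    | cast i => simpa using hρ i
  · have hinj := Finsupp.embDomain_injective (M := ℕ) (Fin.castSuccEmb : Fin (n + 1) ↪ Fin (n + 1 + 1))
    unfold wnorm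
    rw [← hinj.tsum_eq]
    · refine tsum_congr fun d => ?_
      rw [MvPowerSeries.coeff_embDomain_rename]
      congr 2
      have hc : ∀ i : Fin (n + 1), Finsupp.embDomain Fin.castSuccEmb d i.castSucc = d i := fun i =>
        Finsupp.embDomain_apply_self Fin.castSuccEmb d i
      have hl : Finsupp.embDomain Fin.castSuccEmb d (Fin.last (n + 1)) = 0 :=
        Finsupp.embDomain_of_notMem_range _ _ _ (by simp)
      rw [wt, wt, Fin.prod_univ_castSucc, ← Fin.castSucc_zero, hc, Fin.succ_last, hl]
      simp only [Fin.snoc_castSucc, pow_zero, mul_one, Fin.succ_castSucc, hc]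
    · intro d hd
      by_contra hd'
      refine hd ?_
      beta_reduce
      rw [MvPowerSeries.coeff_rename_eq_zero]
      · simp
      · rintro ⟨e, rfl⟩
        exact hd' ⟨e, Finsupp.embDomain_eq_mapDomain _ _⟩

/-- Convergent series as convergent series in one more variable. -/
noncomputable def addVariable (W : WeightFamily S) (n : ℕ) (h : ℝ) :
    W.conv n h →+* W.conv (n + 1) h :=
  (MvPowerSeries.rename (R := ℂ) (Fin.castSuccEmb : Fin (n + 1) ↪ Fin (n + 1 + 1))).toRingHom.restrict
    _ _ fun _ hf => rename_castSucc_mem_conv hf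

end WeightFamily

/-! ### Noetherianity -/

namespace WeightFamily

variable {S : ℝ} {W : WeightFamily S} {n : ℕ} {h : ℝ}

lemma coeff_rename_mul_X_pow (c : MvPowerSeries (Fin (n + 1)) ℂ) (e : Fin (n + 1) →₀ ℕ) (i j : ℕ) :
    MvPowerSeries.coeff (Finsupp.embDomain Fin.castSuccEmb e + Finsupp.single (Fin.last (n + 1)) j)
      (MvPowerSeries.rename (Fin.castSuccEmb : Fin (n + 1) ↪ Fin (n + 1 + 1)) c *
        MvPowerSeries.X (Fin.last (n + 1)) ^ i) = if i = j then MvPowerSeries.coeff e c else 0 := by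
  classical
  have hl : ∀ e : Fin (n + 1) →₀ ℕ, Finsupp.embDomain Fin.castSuccEmb e (Fin.last (n + 1)) = 0 :=
    fun e => Finsupp.embDomain_of_notMem_range _ _ _ (by simp)
  rw [MvPowerSeries.X_pow_eq, MvPowerSeries.coeff_mul_monomial, mul_one]
  by_cases hij : i = j
  · rw [hij, if_pos le_add_self, if_pos rfl, add_tsub_cancel_right,
      MvPowerSeries.coeff_embDomain_rename]
  · rw [if_neg hij]
    split_ifs with hle
    · refine MvPowerSeries.coeff_rename_eq_zero _ _ ?_
      rintro ⟨e', he'⟩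
      have h1 := DFunLike.congr_fun he' (Fin.last (n + 1))
      have h2 := hle (Fin.last (n + 1))
      rw [← Finsupp.embDomain_eq_mapDomain, hl] at h1
      simp [hl] at h1 h2
      omega
    · rfl

lemma exists_eq_embDomain_add (d : Fin (n + 1 + 1) →₀ ℕ) : ∃ e : Fin (n + 1) →₀ ℕ,
    d = Finsupp.embDomain Fin.castSuccEmb e +
      Finsupp.single (Fin.last (n + 1)) (d (Fin.last (n + 1))) := by
  refine ⟨Finsupp.equivFunOnFinite.symm fun i => d i.castSucc, ?_⟩
  ext i
  cases i using Fin.lastCases with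
  | last =>
    rw [Finsupp.add_apply, Finsupp.embDomain_of_notMem_range _ _ _ (by simp)]
    simp
  | cast i =>
    have := Finsupp.embDomain_apply_self Fin.castSuccEmb
      (Finsupp.equivFunOnFinite.symm fun i => d i.castSucc) i
    rw [Fin.castSuccEmb_apply] at this
    rw [Finsupp.add_apply, this, Finsupp.single_apply, if_neg (Fin.castSucc_lt_last i).ne']
    simp

/-- The coefficients of a convergent series with respect to the last variable are convergent. -/
lemma coeff_last_mem_conv {r : MvPowerSeries (Fin (n + 1 + 1)) ℂ} (hr : r ∈ W.conv (n + 1) h)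
    (i : ℕ) {c : MvPowerSeries (Fin (n + 1)) ℂ} (hc : ∀ e, MvPowerSeries.coeff e c =
      MvPowerSeries.coeff (Finsupp.embDomain Fin.castSuccEmb e +
        Finsupp.single (Fin.last (n + 1)) i) r) : c ∈ W.conv n h := by
  obtain ⟨ρ, hρ, hr⟩ := hr
  refine ⟨fun j => ρ j.castSucc, fun j => hρ _, fun l hl => ?_⟩
  have hinj : Function.Injective fun e : Fin (n + 1) →₀ ℕ =>
      Finsupp.embDomain Fin.castSuccEmb e + Finsupp.single (Fin.last (n + 1)) i :=
    (add_left_injective _).comp (Finsupp.embDomain_injective _)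
  have hwt : ∀ e : Fin (n + 1) →₀ ℕ, wt (W.u l) (fun j => ρ j.castSucc) e =
      (ρ (Fin.last n) ^ i)⁻¹ * wt (W.u l) ρ (Finsupp.embDomain Fin.castSuccEmb e +
        Finsupp.single (Fin.last (n + 1)) i) := fun e => by
    have hce : ∀ j : Fin (n + 1), Finsupp.embDomain Fin.castSuccEmb e j.castSucc = e j := fun j =>
      Finsupp.embDomain_apply_self Fin.castSuccEmb e j
    have hle : Finsupp.embDomain Fin.castSuccEmb e (Fin.last (n + 1)) = 0 :=
      Finsupp.embDomain_of_notMem_range _ _ _ (by simp)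
    have h1 := (pow_pos (hρ (Fin.last n)) i).ne'
    have hs : ∀ j : Fin (n + 1), Finsupp.single (Fin.last (n + 1)) i j.castSucc = 0 := fun j => by
      rw [Finsupp.single_apply, if_neg (Fin.castSucc_lt_last j).ne']
    rw [← Fin.succ_last] at hle
    simp only [wt, Fin.prod_univ_castSucc, ← Fin.castSucc_zero, Finsupp.add_apply, hce, hs,
      Fin.succ_castSucc, add_zero, Fin.succ_last]
    rw [← Fin.succ_last, hle, Finsupp.single_eq_same, zero_add]
    field_simp
  calc wnorm (wt (W.u l) fun j => ρ j.castSucc) c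
      = ((ρ (Fin.last n) ^ i)⁻¹ : ℝ≥0) * ∑' e : Fin (n + 1) →₀ ℕ, ‖MvPowerSeries.coeff
          (Finsupp.embDomain Fin.castSuccEmb e + Finsupp.single (Fin.last (n + 1)) i) r‖ₑ *
          (wt (W.u l) ρ (Finsupp.embDomain Fin.castSuccEmb e +
            Finsupp.single (Fin.last (n + 1)) i) : ℝ≥0∞) := by
        rw [wnorm, ← ENNReal.tsum_mul_left]
        refine tsum_congr fun e => ?_
        rw [hc, hwt, ENNReal.coe_mul]
        ring
    _ ≤ ((ρ (Fin.last n) ^ i)⁻¹ : ℝ≥0) * wnorm (wt (W.u l) ρ) r := by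
        gcongr
        exact ENNReal.tsum_comp_le_tsum_of_injective hinj fun d => ‖MvPowerSeries.coeff d r‖ₑ *
          (wt (W.u l) ρ d : ℝ≥0∞)
    _ < ⊤ := ENNReal.mul_lt_top ENNReal.coe_lt_top (hr l hl)

/-- A convergent series that is a polynomial in the last variable. -/
lemma exists_eq_sum_addVariable {m : ℕ} {r : W.conv (n + 1) h}
    (hr : ∀ d : Fin (n + 1 + 1) →₀ ℕ, m ≤ d (Fin.last _) → MvPowerSeries.coeff d r.1 = 0) :
    ∃ c : ℕ → W.conv n h, r = ∑ i ∈ Finset.range m,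
      W.addVariable n h (c i) * ⟨MvPowerSeries.X (Fin.last (n + 1)), X_mem_conv _⟩ ^ i := by
  let c : ℕ → MvPowerSeries (Fin (n + 1)) ℂ := fun i e => MvPowerSeries.coeff
    (Finsupp.embDomain Fin.castSuccEmb e + Finsupp.single (Fin.last (n + 1)) i) r.1
  have hc : ∀ i, c i ∈ W.conv n h := fun i => coeff_last_mem_conv r.2 i fun e => rfl
  refine ⟨fun i => ⟨c i, hc i⟩, Subtype.ext (MvPowerSeries.ext fun d => ?_)⟩
  have h1 : (∑ i ∈ Finset.range m, W.addVariable n h ⟨c i, hc i⟩ *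
      ⟨MvPowerSeries.X (Fin.last (n + 1)), X_mem_conv _⟩ ^ i : W.conv (n + 1) h).1 =
      ∑ i ∈ Finset.range m, MvPowerSeries.rename
        (Fin.castSuccEmb : Fin (n + 1) ↪ Fin (n + 1 + 1)) (c i) *
          MvPowerSeries.X (Fin.last (n + 1)) ^ i := by
    rw [AddSubmonoidClass.coe_finsetSum]
    rfl
  rw [h1, map_sum]
  obtain ⟨e, he⟩ := exists_eq_embDomain_add d
  have hrd := hr d
  generalize d (Fin.last (n + 1)) = j at he hrd
  subst he
  simp only [coeff_rename_mul_X_pow, Finset.sum_ite_eq', Finset.mem_range]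
  split_ifs with hjm
  · rfl
  · exact hrd (not_lt.1 hjm)

/-- An ideal containing a series that is regular in the last variable is finitely generated. -/
lemma fg_of_regular_mem (hh0 : 0 < h) (hh : h ≤ S) (hA : IsNoetherianRing (W.conv n h))
    {J : Ideal (W.conv (n + 1) h)} {g : W.conv (n + 1) h} (hgJ : g ∈ J) {m : ℕ}
    (hgm : MvPowerSeries.coeff (Finsupp.single (Fin.last _) m) g.1 ≠ 0) : J.FG := by
  classical
  let _ : Algebra (W.conv n h) (W.conv (n + 1) h) := (W.addVariable n h).toAlgebra
  -- The least such exponent is used, so that the lower pure powers vanish as Weierstrass division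
  -- demands.
  have H : ∃ m, MvPowerSeries.coeff (Finsupp.single (Fin.last _) m) g.1 ≠ 0 := ⟨m, hgm⟩
  let x : W.conv (n + 1) h := ⟨MvPowerSeries.X (Fin.last (n + 1)), X_mem_conv _⟩
  -- `N` contains all remainders of division by g. It is a finite module over a Noetherian ring, so
  -- J ∩ N is finitely generated; g and generators of J ∩ N generate J, because the remainder of an
  -- element of J lies again in J.
  let N : Submodule (W.conv n h) (W.conv (n + 1) h) :=
    Submodule.span _ ((fun i => x ^ i) '' (Finset.range (Nat.find H) : Set ℕ))
  have hN : IsNoetherian (W.conv n h) N :=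
    isNoetherian_span_of_finite _ ((Finset.finite_toSet _).image _)
  obtain ⟨s, hs⟩ := isNoetherian_submodule.1 hN (J.restrictScalars (W.conv n h) ⊓ N) inf_le_right
  have hsJ : ∀ f ∈ s, f ∈ J := fun f hf => by
    have : f ∈ J.restrictScalars (W.conv n h) ⊓ N := hs ▸ Submodule.subset_span hf
    exact this.1
  refine ⟨insert g s, le_antisymm (Ideal.span_le.2 fun f hf => ?_) fun f hf => ?_⟩
  · rcases Finset.mem_insert.1 (Finset.mem_coe.1 hf) with rfl | hf
    · exact hgJ
    · exact hsJ f hf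
  · obtain ⟨q, hq, hr⟩ := weierstrass_division hh0 hh f.2 g.2 (Nat.find_spec H)
      fun i hi => not_not.1 (Nat.find_min H hi)
    obtain ⟨c, hc⟩ := exists_eq_sum_addVariable (r := f - ⟨q, hq⟩ * g) hr
    have h1 : f - ⟨q, hq⟩ * g ∈ J.restrictScalars (W.conv n h) ⊓ N := by
      refine ⟨J.sub_mem hf (J.mul_mem_left _ hgJ), ?_⟩
      rw [hc]
      refine Submodule.sum_mem _ fun i hi => ?_
      exact Submodule.smul_mem _ (c i) (Submodule.subset_span ⟨i, hi, rfl⟩)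
    rw [← hs] at h1
    have h2 : f - ⟨q, hq⟩ * g ∈ Ideal.span ((insert g s : Finset _) : Set (W.conv (n + 1) h)) :=
      Submodule.span_mono (s := (s : Set (W.conv (n + 1) h))) (by simp)
        (Submodule.span_le_restrictScalars (W.conv n h) (W.conv (n + 1) h) _ h1)
    rw [← sub_add_cancel f (⟨q, hq⟩ * g)]
    exact Ideal.add_mem _ h2 (Ideal.mul_mem_left _ _ (Ideal.subset_span (by simp)))

/-- An ideal containing a series that does not vanish modulo `t` is finitely generated. -/
lemma fg_of_coeff_ne_zero (hh0 : 0 < h) (hh : h ≤ S)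
    (hA : ∀ k, n = k + 1 → IsNoetherianRing (W.conv k h))
    {J : Ideal (W.conv n h)} {g : W.conv n h} (hgJ : g ∈ J) {d : Fin (n + 1) →₀ ℕ} (hd : d 0 = 0)
    (hg : MvPowerSeries.coeff d g.1 ≠ 0) : J.FG := by
  cases n with
  | zero =>
    -- Without variables z, a series that does not vanish modulo t has a nonzero constant term, so J
    -- is the whole ring.
    have : d = 0 := by
      ext i
      rw [Fin.fin_one_eq_zero i, hd]
      rfl
    rw [J.eq_top_of_isUnit_mem hgJ (isUnit_conv hh0 hh (this ▸ hg))]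
    exact ⟨{1}, by simp⟩
  | succ k =>
    obtain ⟨L, m, hm⟩ := exists_linearChange_regular hh0 hh hd hg
    have h1 := fg_of_regular_mem hh0 hh (hA k rfl)
      (Ideal.mem_map_of_mem (linearChange hh0 hh L).toRingHom hgJ) hm
    have h2 := Ideal.FG.map h1 (linearChange hh0 hh L).symm.toRingHom
    rw [Ideal.map_map] at h2
    simpa using h2

lemma exists_eq_X_mul (hh : h ≤ S) {f : W.conv n h}
    (hf : ∀ e : Fin (n + 1) →₀ ℕ, e 0 = 0 → MvPowerSeries.coeff e f.1 = 0) :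
    ∃ g : W.conv n h, f = ⟨MvPowerSeries.X 0, X_mem_conv _⟩ * g ∧
      ∀ e, MvPowerSeries.coeff e g.1 = MvPowerSeries.coeff (e + Finsupp.single 0 1) f.1 := by
  classical
  refine ⟨⟨shift (Finsupp.single 0 1) f.1, shift_mem_conv hh f.2 0 fun d _ => coeff_shift _ _ _⟩,
    Subtype.ext (MvPowerSeries.ext fun d => ?_), fun e => coeff_shift _ _ _⟩
  change _ = MvPowerSeries.coeff d (MvPowerSeries.X 0 * shift (Finsupp.single 0 1) f.1)
  rw [MvPowerSeries.X, MvPowerSeries.coeff_monomial_mul, one_mul]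
  split_ifs with hd
  · rw [coeff_shift, tsub_add_cancel_of_le hd]
  · refine hf d (not_not.1 fun h0 => hd ?_)
    rw [Finsupp.single_le_iff]
    exact Nat.one_le_iff_ne_zero.2 h0

/-- A nonzero convergent series is a power of `t` times a series that does not vanish
modulo `t`. -/
lemma exists_eq_X_pow_mul (hh : h ≤ S) (m : ℕ) {f : W.conv n h} {d : Fin (n + 1) →₀ ℕ}
    (hdm : d 0 ≤ m) (hd : MvPowerSeries.coeff d f.1 ≠ 0) :
    ∃ (k : ℕ) (g : W.conv n h) (e : Fin (n + 1) →₀ ℕ), e 0 = 0 ∧ MvPowerSeries.coeff e g.1 ≠ 0 ∧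
      f = ⟨MvPowerSeries.X 0, X_mem_conv _⟩ ^ k * g := by
  induction m generalizing f d with
  | zero => exact ⟨0, f, d, Nat.le_zero.1 hdm, hd, by simp⟩
  | succ m ih =>
    by_cases hf : ∀ e : Fin (n + 1) →₀ ℕ, e 0 = 0 → MvPowerSeries.coeff e f.1 = 0
    · obtain ⟨g, rfl, hg⟩ := exists_eq_X_mul hh hf
      have hd0 : d 0 ≠ 0 := fun h0 => hd (hf d h0)
      have hle : Finsupp.single 0 1 ≤ d := by
        rw [Finsupp.single_le_iff]
        exact Nat.one_le_iff_ne_zero.2 hd0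
      obtain ⟨k, g', e, he, hg', rfl⟩ := ih (f := g) (d := d - Finsupp.single 0 1)
        (by simp; omega) (by rwa [hg, tsub_add_cancel_of_le hle])
      exact ⟨k + 1, g', e, he, hg', by ring⟩
    · push Not at hf
      obtain ⟨e, he, hfe⟩ := hf
      exact ⟨0, f, e, he, hfe, by simp⟩

/-- By Cohen's theorem it suffices to treat a prime J. If J contains a series that is nonzero modulo
t, Weierstrass division and induction on n apply. Otherwise a nonzero element of J is t^k g with g
nonzero modulo t, hence not in J; so t is in J, and J = (t). -/
theorem isNoetherianRing_conv (hh0 : 0 < h) (hh : h ≤ S) (n : ℕ) :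
    IsNoetherianRing (W.conv n h) := by
  induction n using Nat.strong_induction_on with | _ n ih => ?_
  refine IsNoetherianRing.of_prime fun J hJ => ?_
  by_cases H : ∀ f ∈ J, ∀ d : Fin (n + 1) →₀ ℕ, d 0 = 0 → MvPowerSeries.coeff d f.1 = 0
  · by_cases hJ0 : J = ⊥
    · exact hJ0 ▸ Submodule.fg_bot
    obtain ⟨f, hfJ, hf0⟩ := Submodule.exists_mem_ne_zero_of_ne_bot hJ0
    obtain ⟨d, hd⟩ : ∃ d, MvPowerSeries.coeff d f.1 ≠ 0 := by
      by_contra! H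
      exact hf0 (Subtype.ext (MvPowerSeries.ext H))
    obtain ⟨k, g, e, he, hg, rfl⟩ := exists_eq_X_pow_mul hh _ le_rfl hd
    have hT := hJ.mem_of_pow_mem k ((hJ.mem_or_mem hfJ).resolve_right fun hgJ => hg (H g hgJ e he))
    refine ⟨{⟨MvPowerSeries.X 0, X_mem_conv _⟩}, le_antisymm ?_ fun f hf => ?_⟩
    · rw [Submodule.span_le]
      simpa using hT
    · obtain ⟨g, rfl, -⟩ := exists_eq_X_mul hh (H f hf)
      exact Ideal.mul_mem_right _ _ (Ideal.subset_span (by simp))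
  · push Not at H
    obtain ⟨g, hgJ, d, hd, hg⟩ := H
    exact fg_of_coeff_ne_zero hh0 hh (fun k hk => ih k (by omega)) hgJ hd hg

end WeightFamily

/-- Faithful flatness is invariant under isomorphisms of rings. -/
lemma RingHom.FaithfullyFlat.of_ringEquiv {A B A' B' : Type*} [CommRing A] [CommRing B]
    [CommRing A'] [CommRing B'] {φ : A →+* B} (hφ : φ.FaithfullyFlat) {φ' : A' →+* B'}
    (eA : A ≃+* A') (eB : B ≃+* B') (H : ∀ a, φ' (eA a) = eB (φ a)) : φ'.FaithfullyFlat := by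
  rw [RingHom.FaithfullyFlat.iff_flat_and_comap_surjective] at hφ ⊢
  refine ⟨?_, ?_⟩
  · algebraize [φ, φ']
    have h1 : Module.Flat A B := hφ.1
    change Module.Flat A' B'
    rw [Module.Flat.iff_forall_isTrivialRelation] at h1 ⊢
    intro l f x hfx
    have h2 : ∑ i, eA.symm (f i) • eB.symm (x i) = 0 := by
      apply eB.injective
      rw [map_sum, map_zero, ← hfx]
      refine Finset.sum_congr rfl fun i _ => ?_
      rw [Algebra.smul_def, Algebra.smul_def, map_mul]
      change eB (φ (eA.symm (f i))) * _ = φ' (f i) * _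
      rw [← H]
      simp
    obtain ⟨k, a, y, hx, hf⟩ := h1 h2
    refine ⟨k, fun i j => eA (a i j), fun j => eB (y j), fun i => ?_, fun j => ?_⟩
    · have hx' : eB.symm (x i) = ∑ j, a i j • y j := hx i
      rw [← eB.apply_symm_apply (x i), hx', map_sum]
      refine Finset.sum_congr rfl fun j _ => ?_
      rw [Algebra.smul_def, Algebra.smul_def, map_mul]
      change eB (φ (a i j)) * _ = φ' (eA (a i j)) * _
      rw [H]
    · have := congrArg eA (hf j)
      simpa using this
  · intro p
    obtain ⟨q, hq⟩ := hφ.2 (p.comap (eA : A →+* A'))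
    refine ⟨q.comap (eB.symm : B' →+* B), ?_⟩
    have h1 : (eB.symm : B' →+* B).comp φ' = φ.comp (eA.symm : A' →+* A) := by
      ext a
      have := H (eA.symm a)
      rw [eA.apply_symm_apply] at this
      simp [this]
    have h2 : (eA : A →+* A').comp (eA.symm : A' →+* A) = RingHom.id A' := by ext; simp
    rw [← PrimeSpectrum.comap_comp_apply, h1, PrimeSpectrum.comap_comp_apply, hq,
      ← PrimeSpectrum.comap_comp_apply, h2, PrimeSpectrum.comap_id]

/-! ### Transfer to the stalks -/

namespace WeightFamily

variable {S : ℝ} {W : WeightFamily S} {n : ℕ} {h : ℝ}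

/-- Both routes evaluate the same power series in the same coordinates; only the ring in which the
values are regarded changes. -/
lemma stalkMap_convEquiv {E : Type*} [NormedAddCommGroup E] [NormedSpace ℂ E]
    {M : Type*} [TopologicalSpace M] [ChartedSpace E M] [IsManifold 𝓘(ℂ, E) ω M]
    {k : ℝ} (hk : 0 < k) (hkh : k ≤ h) (hh : h ≤ S) (b : E ≃L[ℂ] (Fin n → ℂ)) (x : M)
    (f : W.conv n h) : W.stalkMap E hkh x (convEquiv (hk.trans_le hkh) hh b x f) =
      convEquiv hk (hkh.trans hh) b x (W.convIncl n hkh f) := by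
  refine Subtype.ext (Filter.Germ.coe_eq.2 ?_)
  filter_upwards [eventually_evalZ (hk.trans_le hkh) hh b x f,
    eventually_evalZ hk (hkh.trans hh) b x (W.convIncl n hkh f)] with y h1 h2
  refine Subtype.ext ?_
  rw [coe_evalHat h2.1]
  exact coe_evalHat h1.1

end WeightFamily

theorem mainTheorem8 {S : ℝ} (W : WeightFamily S)
    {E : Type*} [NormedAddCommGroup E] [NormedSpace ℂ E] [FiniteDimensional ℂ E]
    {M : Type*} [TopologicalSpace M] [ChartedSpace E M] [IsManifold 𝓘(ℂ, E) ω M]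
    (x : M) {k h : ℝ} (hk : 0 < k) (hkh : k < h) (hh : h ≤ S) :
    (W.stalkMap E hkh.le x).FaithfullyFlat := by
  -- Any linear coordinates will do, provided that the same ones are used for `h` and for `k`.
  have b : E ≃L[ℂ] (Fin (Module.finrank ℂ E) → ℂ) :=
    ContinuousLinearEquiv.ofFinrankEq (by simp)
  exact RingHom.FaithfullyFlat.of_ringEquiv
    (WeightFamily.faithfullyFlat_convIncl hk hkh.le hh
      (WeightFamily.isNoetherianRing_conv (hk.trans hkh) hh _)
      (WeightFamily.isNoetherianRing_conv hk (hkh.le.trans hh) _))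
    (WeightFamily.convEquiv (hk.trans hkh) hh b x)
    (WeightFamily.convEquiv hk (hkh.le.trans hh) b x)
    (WeightFamily.stalkMap_convEquiv hk hkh.le hh b x)
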